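/- Let $k$ be an algebraically closed field and let $\mathfrak a$ be a finite $k$-variety, i.e. a $k$-linear additive category with finite-dimensional Hom-spaces in which idempotents split. Let $\operatorname{mod}\mathfrak a$ be the category of finitely presented right $\mathfrak a$-modules, i.e. of those contravariant functors $M$ from $\mathfrak a$ to $k$-vector spaces for which there is an exact sequence $\mathfrak a(-,A)\to\mathfrak a(-,B)\to M\to 0$ with $A,B\in\mathfrak a$; write $\mathfrak a^\circ$ for the dual category of $\mathfrak a$. Call $\mathfrak a$ a dualizing $k$-variety if the vector space dual $D$, $(DM)(x)=\operatorname{Hom}_k(M(x),k)$, restricts to a duality $D:\operatorname{mod}\mathfrak a\to\operatorname{mod}\mathfrak a^\circ$ (in that case $\operatorname{mod}\mathfrak a$ is abelian). An abelian $k$-linear category $\mathcal A$ is said to have Serre duality if its bounded derived category $D^b\mathcal A$ is Hom-finite and admits a Serre functor, i.e. an additive auto-equivalence $\mathbb S$ with isomorphisms $\operatorname{Hom}(X,Y)\cong\operatorname{Hom}(Y,\mathbb S X)^*$ natural in $X,Y\in D^b\mathcal A$, where $(-)^*$ is the $k$-linear dual. Then the following are equivalent: 1. $\operatorname{mod}\mathfrak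 a$ is abelian and has Serre duality; 2. $\mathfrak a$ is a dualizing $k$-variety and every object of $\operatorname{mod}\mathfrak a$ has finite projective dimension and finite injective dimension in $\operatorname{mod}\mathfrak a$. -/

import Mathlib

open CategoryTheory Opposite

universe w v u

namespace FiniteVariety

/-! ### Finite `k`-varieties and their modules -/

/-- A finite `k`-variety: a `k`-linear additive category with finite dimensional Hom-spaces in
which idempotents split. -/
class IsFiniteVariety (k : Type v) [Field k] (𝔞 : Type u) [Category.{v} 𝔞] [Preadditive 𝔞]
    [Linear k 𝔞] : Prop where
  hasFiniteBiproducts : Limits.HasFiniteBiproducts 𝔞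
  isIdempotentComplete : IsIdempotentComplete 𝔞
  finiteDimensional_hom : ∀ X Y : 𝔞, FiniteDimensional k (X ⟶ Y)

/-- A right `𝔞`-module `M` is finitely presented (by standard projectives) if there is an exact
sequence `𝔞(-,A) ⟶ 𝔞(-,B) ⟶ M ⟶ 0`; exactness of a sequence of modules is tested at every object.
(In an additive category a finite direct sum of standard projectives is a standard projective.) -/
def isFinitelyPresented (k : Type v) [Field k] (𝔞 : Type u) [Category.{v} 𝔞] [Preadditive 𝔞]
    [Linear k 𝔞] : ObjectProperty (𝔞ᵒᵖ ⥤ ModuleCat.{v} k) := fun M ↦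
  ∃ (A B : 𝔞) (g : (linearYoneda k 𝔞).obj A ⟶ (linearYoneda k 𝔞).obj B)
    (p : (linearYoneda k 𝔞).obj B ⟶ M),
    ∀ X : 𝔞ᵒᵖ, Function.Exact (g.app X).hom (p.app X).hom ∧ Function.Surjective (p.app X).hom

/-- `mod 𝔞`, the category of finitely presented right `𝔞`-modules, as a full subcategory of the
category of contravariant functors from `𝔞` to `k`-vector spaces. -/
abbrev FPMod (k : Type v) [Field k] (𝔞 : Type u) [Category.{v} 𝔞] [Preadditive 𝔞]
    [Linear k 𝔞] : Type (max u (v + 1)) :=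
  (isFinitelyPresented k 𝔞).FullSubcategory

/-! ### Duality -/

/-- The dual category of a `k`-linear category is `k`-linear. -/
instance oppositeLinear (k : Type v) [Field k] (𝔞 : Type u) [Category.{v} 𝔞] [Preadditive 𝔞]
    [Linear k 𝔞] : Linear k 𝔞ᵒᵖ where
  homModule X Y := (opEquiv X Y).module k
  smul_comp _ _ _ r f g := Quiver.Hom.unop_inj (Linear.comp_smul _ _ _ g.unop r f.unop)
  comp_smul _ _ _ f r g := Quiver.Hom.unop_inj (Linear.smul_comp _ _ _ r g.unop f.unop)

/-- The vector space dual `V ↦ V^*`, as a contravariant functor. -/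
def vectorSpaceDual (k : Type v) [Field k] : (ModuleCat.{v} k)ᵒᵖ ⥤ ModuleCat.{v} k where
  obj V := ModuleCat.of k (Module.Dual k V.unop)
  map f := ModuleCat.ofHom (Module.Dual.transpose (R := k) f.unop.hom)

/-- The functor `D` from right `𝔞`-modules to right `𝔞ᵒᵖ`-modules, `(D M)(x) = Hom_k(M(x), k)`. -/
def moduleDual (k : Type v) [Field k] (𝔞 : Type u) [Category.{v} 𝔞] :
    (𝔞ᵒᵖ ⥤ ModuleCat.{v} k)ᵒᵖ ⥤ (𝔞ᵒᵖᵒᵖ ⥤ ModuleCat.{v} k) :=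
  Functor.opHom 𝔞ᵒᵖ (ModuleCat.{v} k) ⋙ (Functor.whiskeringRight _ _ _).obj (vectorSpaceDual k)

/-- `𝔞` is dualizing if `D` restricts to a duality between `mod 𝔞` and `mod 𝔞ᵒᵖ`. -/
def IsDualizing (k : Type v) [Field k] (𝔞 : Type u) [Category.{v} 𝔞] [Preadditive 𝔞]
    [Linear k 𝔞] : Prop :=
  ∃ h : ∀ M : (FPMod k 𝔞)ᵒᵖ,
      isFinitelyPresented k 𝔞ᵒᵖ ((moduleDual k 𝔞).obj (op M.unop.obj)),
    ((isFinitelyPresented k 𝔞ᵒᵖ).lift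
      ((isFinitelyPresented k 𝔞).ι.op ⋙ moduleDual k 𝔞) h).IsEquivalence

/-! ### Abelian categories, with the additive structure fixed -/

/-- The property of a preadditive category of being abelian. -/
structure IsAbelian (C : Type u) [Category.{v} C] [Preadditive C] : Prop where
  hasFiniteProducts : Limits.HasFiniteProducts C
  hasKernels : Limits.HasKernels C
  hasCokernels : Limits.HasCokernels C
  isNormalMonoCategory : IsNormalMonoCategory C
  isNormalEpiCategory : IsNormalEpiCategory C

/-- The structure of an abelian category which extends the given preadditive structure. -/
abbrev IsAbelian.abelian {C : Type u} [Category.{v} C] [Preadditive C] (h : IsAbelian C) :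
    Abelian C :=
  { ‹Preadditive C›, h.isNormalMonoCategory, h.isNormalEpiCategory with
    has_finite_products := h.hasFiniteProducts
    has_kernels := h.hasKernels
    has_cokernels := h.hasCokernels }

/-! ### Serre duality -/

/-- A Serre functor on a `k`-linear category `C`: an additive auto-equivalence `S` with
isomorphisms `Hom(X, Y) ≅ Hom(Y, S X)^*` natural in `X` and `Y`. -/
structure SerreFunctor (k : Type w) [Field k] (C : Type u) [Category.{v} C] [Preadditive C]
    [Linear k C] where
  S : C ≌ C
  additive : S.functor.Additive
  iso (X Y : C) : (X ⟶ Y) ≃ₗ[k] Module.Dual k (Y ⟶ S.functor.obj X)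
  iso_naturality {X' X Y Y' : C} (f : X' ⟶ X) (φ : X ⟶ Y) (g : Y ⟶ Y')
    (ψ : Y' ⟶ S.functor.obj X') :
    iso X' Y' (f ≫ φ ≫ g) ψ = iso X Y φ (g ≫ ψ ≫ S.functor.map f)

/-- A `k`-linear (triangulated) category has Serre duality if it is Hom-finite and admits a Serre
functor. -/
def HasSerreDuality (k : Type w) [Field k] (C : Type u) [Category.{v} C] [Preadditive C]
    [Linear k C] : Prop :=
  (∀ X Y : C, FiniteDimensional k (X ⟶ Y)) ∧ Nonempty (SerreFunctor k C)

/-- The bounded derived category `D^b A`, as the full subcategory of the derived category consisting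
of the objects with bounded cohomology. -/
abbrev BoundedDerivedCategory (A : Type u) [Category.{v} A] [Abelian A]
    [HasDerivedCategory.{w} A] : Type (max u v) :=
  (DerivedCategory.TStructure.t (C := A)).bounded.FullSubcategory

/-- An abelian `k`-linear category satisfies Serre duality if its bounded derived category has
Serre duality. -/
def SatisfiesSerreDuality (k : Type w) [Field k] (A : Type u) [Category.{v} A] [Abelian A]
    [Linear k A] : Prop :=
  letI := HasDerivedCategory.standard A
  HasSerreDuality k (BoundedDerivedCategory A)

/-! ### Homological dimensions -/

/-- Every object of the abelian category `A` has finite projective and finite injective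
dimension. (`mod 𝔞` is abelian as soon as `𝔞` is dualizing, so for a dualizing `𝔞` the requirement
that this hold for every proof that `mod 𝔞` is abelian is a genuine one.) -/
def ObjectsHaveFiniteDimensions (A : Type u) [Category.{v} A] [Abelian A] : Prop :=
  ∀ M : A, (∃ n : ℕ, HasProjectiveDimensionLE M n) ∧ (∃ n : ℕ, HasInjectiveDimensionLE M n)

end FiniteVariety

/-! On a Hom-finite category a Serre functor can be assembled object by object: each `X` needs a `Z`
and a linear form on `X ⟶ Z` whose pairings are all nondegenerate (`IsSerreTrace`), and each object
must also occur as such a `Z` (`hasSerreDuality_of_isSerreDual`). The link with modules is that, in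
`mod 𝔞`, a module `I` is Serre dual to the standard projective `𝔞(-,b)` exactly when `D I ≅ 𝔞(b,-)`:
see `isSerreDual_standardProjective_of_iso` and `IsSerreDual.nonempty_iso_moduleDual`.

From dualizing to Serre duality: `D` provides enough injectives, and passing to retracts gives every
projective and every injective module a Serre partner in `mod 𝔞`. Such a pair remains a Serre pair
in the derived category (`IsSerreDual.boundedSingle`), because a projective and an injective have no
higher Ext in the relevant variable. Serre pairs extend along distinguished triangles
(`IsSerreTrace.isSerreDual_of_distinguished`), so truncations and finite resolutions reach every
bounded object.

From Serre duality to dualizing: boundedness of Serre partners forces finite homological dimensions.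
The partner `Z` of `P_b = 𝔞(-,b)` satisfies `Hom(P_c[n], Z) ≅ Hom(P_b, P_c[n])^* = 0` for `n ≠ 0`,
so it is a module `I_b`. The delicate point is that each module `M` embeds in some `I_b`
(`HasSerreDuality.exists_mono`). If `M` is the Serre dual of `X`, then `X` behaves like a bounded
complex of projectives in degrees `≥ 0`, and its degree-zero term `P` carries a map `X ⟶ P` through
which all maps from `X` to standard projectives factor (`exists_boundedSingle_shift_factorization`).
Dually, all maps from `M` to the `I_a` factor through one `M ⟶ I_b`, which must then be mono.
Copresentations by the `I_b` are dualized by `D` into presentations by representables, and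
conversely. -/

namespace FiniteVariety

open Limits

/-! ### Serre traces -/

section SerreTrace

variable {k : Type w} [Field k] {C : Type u} [Category.{v} C] [Preadditive C] [Linear k C]

/-- A linear form on `X ⟶ Z` is a Serre trace if all the pairings
`(X ⟶ Y) × (Y ⟶ Z) → (X ⟶ Z) → k` are nondegenerate. -/
structure IsSerreTrace {X Z : C} (η : Module.Dual k (X ⟶ Z)) : Prop where
  left : ∀ {Y : C} (f : X ⟶ Y), (∀ g : Y ⟶ Z, η (f ≫ g) = 0) → f = 0
  right : ∀ {Y : C} (g : Y ⟶ Z), (∀ f : X ⟶ Y, η (f ≫ g) = 0) → g = 0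

variable (k) in
/-- `Z` is a Serre dual of `X`. -/
def IsSerreDual (X Z : C) : Prop := ∃ η : Module.Dual k (X ⟶ Z), IsSerreTrace η

/-- The pairing `(X ⟶ Y) × (Y ⟶ Z) → k` attached to a linear form on `X ⟶ Z`. -/
def tracePairing {X Z : C} (η : Module.Dual k (X ⟶ Z)) (Y : C) :
    (X ⟶ Y) →ₗ[k] Module.Dual k (Y ⟶ Z) :=
  LinearMap.compr₂ (Linear.comp X Y Z) η

namespace IsSerreTrace

variable {X Z : C} {η : Module.Dual k (X ⟶ Z)} (hη : IsSerreTrace η)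

include hη

lemma tracePairing_injective (Y : C) : Function.Injective (tracePairing η Y) := by
  rw [injective_iff_map_eq_zero]
  exact fun f hf ↦ hη.left f fun g ↦ DFunLike.congr_fun hf g

lemma tracePairing_flip_injective (Y : C) : Function.Injective (tracePairing η Y).flip := by
  rw [injective_iff_map_eq_zero]
  exact fun g hg ↦ hη.right g fun f ↦ DFunLike.congr_fun hg f

lemma left_ext {Y : C} {f f' : X ⟶ Y} (h : ∀ g : Y ⟶ Z, η (f ≫ g) = η (f' ≫ g)) : f = f' :=
  hη.tracePairing_injective Y (LinearMap.ext h)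

lemma right_ext {Y : C} {g g' : Y ⟶ Z} (h : ∀ f : X ⟶ Y, η (f ≫ g) = η (f ≫ g')) : g = g' :=
  hη.tracePairing_flip_injective Y (LinearMap.ext h)

lemma exists_left {Y : C} [FiniteDimensional k (Y ⟶ Z)] (φ : Module.Dual k (Y ⟶ Z)) :
    ∃ f : X ⟶ Y, ∀ g, η (f ≫ g) = φ g := by
  obtain ⟨f, hf⟩ := LinearMap.flip_injective_iff₂.1 (hη.tracePairing_flip_injective Y) φ
  exact ⟨f, fun g ↦ DFunLike.congr_fun hf g⟩

lemma exists_right {Y : C} [FiniteDimensional k (X ⟶ Y)] (φ : Module.Dual k (X ⟶ Y)) :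
    ∃ g : Y ⟶ Z, ∀ f, η (f ≫ g) = φ f := by
  obtain ⟨g, hg⟩ := (LinearMap.flip_injective_iff₂ (B := (tracePairing η Y).flip)).1
    (hη.tracePairing_injective Y) φ
  exact ⟨g, fun f ↦ DFunLike.congr_fun hg f⟩

lemma comp_iso_right {Z' : C} (e : Z ≅ Z') :
    IsSerreTrace (η ∘ₗ Linear.rightComp k X e.inv) where
  left f hf := hη.left f fun g ↦ by simpa using hf (g ≫ e.hom)
  right g hg := by
    rw [← cancel_mono e.inv, zero_comp]
    exact hη.right _ fun f ↦ by simpa using hg f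

lemma comp_iso_left {X' : C} (e : X ≅ X') :
    IsSerreTrace (η ∘ₗ Linear.leftComp k Z e.hom) where
  left f hf := by
    rw [← cancel_epi e.hom, comp_zero]
    exact hη.left _ fun g ↦ by simpa using hf g
  right g hg := hη.right g fun f ↦ by simpa using hg (e.inv ≫ f)

end IsSerreTrace

lemma IsSerreDual.of_iso {X X' Z Z' : C} (h : IsSerreDual k X Z) (e : X ≅ X') (e' : Z ≅ Z') :
    IsSerreDual k X' Z' := by
  obtain ⟨η, hη⟩ := h
  exact ⟨_, (hη.comp_iso_left e).comp_iso_right e'⟩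

section HomFinite

variable [∀ X Y : C, FiniteDimensional k (X ⟶ Y)]

/-- The morphism between Serre duals which is induced by a morphism. -/
lemma IsSerreTrace.exists_map {X X' Z Z' : C} {η : Module.Dual k (X ⟶ Z)}
    {η' : Module.Dual k (X' ⟶ Z')} (hη : IsSerreTrace η) (f : X' ⟶ X) :
    ∃ s : Z' ⟶ Z, ∀ h : X ⟶ Z', η' (f ≫ h) = η (h ≫ s) := by
  obtain ⟨s, hs⟩ := hη.exists_right (η' ∘ₗ Linear.leftComp k Z' f)
  exact ⟨s, fun h ↦ (hs h).symm⟩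

lemma IsSerreTrace.exists_preimage {X X' Z Z' : C} {η : Module.Dual k (X ⟶ Z)}
    {η' : Module.Dual k (X' ⟶ Z')} (hη' : IsSerreTrace η') (s : Z' ⟶ Z) :
    ∃ f : X' ⟶ X, ∀ h : X ⟶ Z', η' (f ≫ h) = η (h ≫ s) := by
  obtain ⟨f, hf⟩ := hη'.exists_left (η ∘ₗ Linear.rightComp k X s)
  exact ⟨f, hf⟩

/-- Both objects represent `Y ↦ Hom(X, Y)^*`; the adjoints of `𝟙 X` for the two traces are mutually
inverse. -/
lemma IsSerreDual.nonempty_iso {X Z Z' : C} (h : IsSerreDual k X Z) (h' : IsSerreDual k X Z') :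
    Nonempty (Z ≅ Z') := by
  obtain ⟨η, hη⟩ := h
  obtain ⟨η', hη'⟩ := h'
  obtain ⟨s, hs⟩ := hη'.exists_map (η' := η) (𝟙 X)
  obtain ⟨t, ht⟩ := hη.exists_map (η' := η') (𝟙 X)
  simp only [Category.id_comp] at hs ht
  exact ⟨⟨s, t, hη.right_ext fun h ↦ by rw [← Category.assoc, ← ht, ← hs, Category.comp_id],
    hη'.right_ext fun h ↦ by rw [← Category.assoc, ← hs, ← ht, Category.comp_id]⟩⟩

/-- A Hom-finite linear category in which every object has, and is, a Serre dual has a Serre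
functor. -/
lemma hasSerreDuality_of_isSerreDual (h₁ : ∀ X : C, ∃ Z, IsSerreDual k X Z)
    (h₂ : ∀ Z : C, ∃ X, IsSerreDual k X Z) : HasSerreDuality k C := by
  refine ⟨inferInstance, ?_⟩
  choose S η hη using h₁
  choose σ hσ using fun {X' X : C} (f : X' ⟶ X) ↦ (hη X).exists_map (η' := η X') f
  -- On morphisms the functor is the adjoint for the traces; its laws, fullness and faithfulness all
  -- reduce to nondegeneracy.
  let F : C ⥤ C :=
    { obj := S
      map f := σ f
      map_id X := (hη X).right_ext fun h ↦ by rw [← hσ, Category.id_comp, Category.comp_id]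
      map_comp {X Y Z} f g := (hη Z).right_ext fun h ↦ by
        rw [← hσ, ← Category.assoc h, ← hσ, Category.assoc, hσ f, Category.assoc] }
  have : F.Additive :=
    { map_add {X Y f g} := (hη Y).right_ext fun h ↦ by
        change η Y (h ≫ σ (f + g)) = η Y (h ≫ (σ f + σ g))
        rw [← hσ, Preadditive.comp_add, map_add, ← hσ, ← hσ, Preadditive.add_comp, map_add] }
  have : F.Full :=
    { map_surjective {X Y} s := by
        obtain ⟨f, hf⟩ := (hη X).exists_preimage (η := η Y) s
        exact ⟨f, (hη Y).right_ext fun h ↦ by rw [← hf]; exact (hσ f h).symm⟩ }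
  have : F.Faithful :=
    { map_injective {X Y f g} e := (hη X).left_ext fun h ↦ by
        rw [hσ f, hσ g]; exact congrArg (fun s ↦ η Y (h ≫ s)) e }
  have : F.EssSurj :=
    { mem_essImage Z := by
        obtain ⟨X, hX⟩ := h₂ Z
        obtain ⟨e⟩ := IsSerreDual.nonempty_iso ⟨η X, hη X⟩ hX
        exact ⟨X, ⟨e⟩⟩ }
  have : F.IsEquivalence := {}
  refine ⟨⟨F.asEquivalence, ‹F.Additive›, fun X Y ↦ LinearEquiv.ofBijective
    (tracePairing (η X) Y) ⟨(hη X).tracePairing_injective Y, LinearMap.flip_injective_iff₂.1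
      ((hη X).tracePairing_flip_injective Y)⟩, fun {X' X Y Y'} f φ g ψ ↦ ?_⟩⟩
  change Y' ⟶ S X' at ψ
  refine ((congrArg (η X') (?_ : _ = f ≫ φ ≫ g ≫ ψ)).trans (hσ f (φ ≫ g ≫ ψ))).trans
    (congrArg (η X) (?_ : _ = φ ≫ g ≫ ψ ≫ σ f)) <;> simp

/-- The idempotent of `X` that cuts out `M` has an adjoint idempotent on `Z`; its splitting is the
partner of `M`. This passes from standard projectives to all projectives. -/
lemma IsSerreDual.exists_of_retract_left [IsIdempotentComplete C] {X Z M : C}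
    (h : IsSerreDual k X Z) (ρ : Retract M X) :
    ∃ N : C, Nonempty (Retract N Z) ∧ IsSerreDual k M N := by
  obtain ⟨η, hη⟩ := h
  obtain ⟨s, hs⟩ := hη.exists_map (η' := η) (ρ.r ≫ ρ.i)
  have hss : s ≫ s = s := hη.right_ext fun h ↦ by
    rw [← Category.assoc, ← hs, ← hs, ← Category.assoc, ← hs]; simp
  obtain ⟨N, i, r, hir, hri⟩ := IsIdempotentComplete.idempotents_split Z s hss
  refine ⟨N, ⟨⟨i, r, hir⟩⟩, η ∘ₗ Linear.leftComp k Z ρ.r ∘ₗ Linear.rightComp k M i,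
    ⟨fun {Y} f hf ↦ ?_, fun {Y} g hg ↦ ?_⟩⟩
  · have : ρ.r ≫ f = 0 := hη.left _ fun g ↦ by
      have h₁ := hs (ρ.r ≫ f ≫ g)
      have h₂ := hf (g ≫ r)
      rw [← hri] at h₁
      simp only [Category.assoc, Retract.retract_assoc] at h₁
      simp only [LinearMap.comp_apply, Linear.leftComp_apply, Linear.rightComp_apply,
        Category.assoc] at h₂
      simp [h₁, h₂]
    rw [← ρ.retract_assoc f, this, comp_zero]
  · have : g ≫ i = 0 := hη.right _ fun f ↦ by
      have h₁ := hs (f ≫ g ≫ i)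
      have h₂ := hg (ρ.i ≫ f)
      rw [← hri] at h₁
      simp only [Category.assoc, reassoc_of% hir] at h₁
      simp only [LinearMap.comp_apply, Linear.leftComp_apply, Linear.rightComp_apply,
        Category.assoc] at h₂
      rw [← h₁, h₂]
    rw [← Category.comp_id g, ← hir, reassoc_of% this, zero_comp]

lemma IsSerreDual.exists_of_retract_right [IsIdempotentComplete C] {X Z N : C}
    (h : IsSerreDual k X Z) (ρ : Retract N Z) :
    ∃ M : C, Nonempty (Retract M X) ∧ IsSerreDual k M N := by
  obtain ⟨η, hη⟩ := h
  obtain ⟨e, he⟩ := hη.exists_preimage (η := η) (ρ.r ≫ ρ.i)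
  have hee : e ≫ e = e := hη.left_ext fun h ↦ by
    rw [Category.assoc, he, Category.assoc, he, he]; simp
  obtain ⟨M, i, r, hir, hri⟩ := IsIdempotentComplete.idempotents_split X e hee
  refine ⟨M, ⟨⟨i, r, hir⟩⟩, η ∘ₗ Linear.leftComp k Z r ∘ₗ Linear.rightComp k M ρ.i,
    ⟨fun {Y} f hf ↦ ?_, fun {Y} g hg ↦ ?_⟩⟩
  · have : r ≫ f = 0 := hη.left _ fun g ↦ by
      have h₁ := he (r ≫ f ≫ g)
      have h₂ := hf (g ≫ ρ.r)
      rw [← hri] at h₁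
      simp only [Category.assoc, reassoc_of% hir] at h₁
      simp only [LinearMap.comp_apply, Linear.leftComp_apply, Linear.rightComp_apply,
        Category.assoc] at h₂
      simp [h₁, h₂]
    rw [← Category.id_comp f, ← hir, Category.assoc, this, comp_zero]
  · have : g ≫ ρ.i = 0 := hη.right _ fun f ↦ by
      have h₁ := he (f ≫ g ≫ ρ.i)
      have h₂ := hg (i ≫ f)
      rw [← hri] at h₁
      simp only [Category.assoc, Retract.retract_assoc] at h₁
      simp only [LinearMap.comp_apply, Linear.leftComp_apply, Linear.rightComp_apply,
        Category.assoc] at h₂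
      simp [← h₁, h₂]
    rw [← Category.comp_id g, ← ρ.retract, reassoc_of% this, zero_comp]

/-- `Hom(-, I)` is the dual of `Hom(P, -)`, which preserves monomorphisms, and vector space duality
turns injections into surjections. -/
lemma IsSerreDual.injective {P I : C} (h : IsSerreDual k P I) : Injective I where
  factors {Y Y'} g m _ := by
    obtain ⟨η, hη⟩ := h
    obtain ⟨φ, hφ⟩ := LinearMap.dualMap_surjective_of_injective
      (f := Linear.rightComp k P m) (fun _ _ h ↦ (cancel_mono m).1 h)
      (η ∘ₗ Linear.rightComp k P g)
    obtain ⟨g', hg'⟩ := hη.exists_right φ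
    refine ⟨g', hη.right_ext fun f ↦ ?_⟩
    rw [← Category.assoc, hg']
    exact DFunLike.congr_fun hφ f

lemma IsSerreDual.projective {P I : C} (h : IsSerreDual k P I) : Projective P where
  factors {Y Y'} f p _ := by
    obtain ⟨η, hη⟩ := h
    obtain ⟨φ, hφ⟩ := LinearMap.dualMap_surjective_of_injective
      (f := Linear.leftComp k I p) (fun _ _ h ↦ (cancel_epi p).1 h)
      (η ∘ₗ Linear.leftComp k I f)
    obtain ⟨f', hf'⟩ := hη.exists_left φ
    refine ⟨f', hη.left_ext fun g ↦ ?_⟩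
    rw [Category.assoc, hf']
    exact DFunLike.congr_fun hφ g

end HomFinite

/-- The Serre trace which is given by a Serre functor. -/
def SerreFunctor.trace (s : SerreFunctor k C) (X : C) : Module.Dual k (X ⟶ s.S.functor.obj X) :=
  s.iso X X (𝟙 X)

lemma SerreFunctor.iso_apply (s : SerreFunctor k C) {X Y : C} (f : X ⟶ Y)
    (g : Y ⟶ s.S.functor.obj X) : s.iso X Y f g = s.trace X (f ≫ g) := by
  simpa [trace] using s.iso_naturality (𝟙 X) (𝟙 X) f g

lemma SerreFunctor.isSerreTrace (s : SerreFunctor k C)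
    [∀ X Y : C, FiniteDimensional k (X ⟶ Y)] (X : C) : IsSerreTrace (s.trace X) where
  left {Y} f hf := (s.iso X Y).injective (by
    ext g
    rw [s.iso_apply, hf, map_zero, LinearMap.zero_apply])
  right {Y} g hg := by
    rw [← Module.forall_dual_apply_eq_zero_iff k]
    intro φ
    obtain ⟨f, rfl⟩ := (s.iso X Y).surjective φ
    rw [s.iso_apply, hg]

lemma HasSerreDuality.exists_right (h : HasSerreDuality k C) (X : C) :
    ∃ Z, IsSerreDual k X Z := by
  obtain ⟨_, ⟨s⟩⟩ := h
  exact ⟨_, _, s.isSerreTrace X⟩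

lemma HasSerreDuality.exists_left (h : HasSerreDuality k C) (Z : C) :
    ∃ X, IsSerreDual k X Z := by
  obtain ⟨_, ⟨s⟩⟩ := h
  exact ⟨s.S.inverse.obj Z, IsSerreDual.of_iso ⟨_, s.isSerreTrace _⟩ (Iso.refl _)
    (s.S.counitIso.app Z)⟩

end SerreTrace

end FiniteVariety

namespace FiniteVariety

open Limits Pretriangulated

/-! ### Serre traces in triangulated categories -/

section Functoriality

variable {k : Type w} [Field k] {C D : Type*} [Category* C] [Category* D] [Preadditive C]
  [Preadditive D] [Linear k C] [Linear k D] (F : C ⥤ D) [F.Additive]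

lemma IsSerreTrace.map_of_isEquivalence [F.IsEquivalence] {X Z : C} {η : Module.Dual k (X ⟶ Z)}
    (hη : IsSerreTrace η) {η' : Module.Dual k (F.obj X ⟶ F.obj Z)}
    (h : ∀ x, η' (F.map x) = η x) : IsSerreTrace η' where
  left {Y} f hf := by
    have : F.preimage (f ≫ (F.objObjPreimageIso Y).inv) = 0 := hη.left _ fun g ↦ by
      rw [← h, F.map_comp, F.map_preimage, Category.assoc, hf]
    rw [← cancel_mono (F.objObjPreimageIso Y).inv, ← F.map_preimage (_ ≫ _), this, F.map_zero,
      zero_comp]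
  right {Y} g hg := by
    have : F.preimage ((F.objObjPreimageIso Y).hom ≫ g) = 0 := hη.right _ fun f ↦ by
      rw [← h, F.map_comp, F.map_preimage, ← Category.assoc, hg]
    rw [← cancel_epi (F.objObjPreimageIso Y).hom, ← F.map_preimage (_ ≫ _), this, F.map_zero,
      comp_zero]

variable [F.Linear k]

/-- The linear equivalence on morphisms given by a fully faithful linear functor. -/
noncomputable def homLinearEquiv [F.Full] [F.Faithful] (X Y : C) :
    (X ⟶ Y) ≃ₗ[k] (F.obj X ⟶ F.obj Y) :=
  LinearEquiv.ofBijective (F.mapLinearMap k) ⟨F.map_injective, F.map_surjective⟩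

lemma exists_dual_map [F.Full] [F.Faithful] {X Z : C} (η : Module.Dual k (X ⟶ Z)) :
    ∃ η' : Module.Dual k (F.obj X ⟶ F.obj Z), ∀ x, η' (F.map x) = η x :=
  ⟨η ∘ₗ (homLinearEquiv F X Z).symm.toLinearMap,
    fun x ↦ congrArg η ((homLinearEquiv F X Z).symm_apply_apply x)⟩

lemma IsSerreDual.of_map [F.Full] [F.Faithful] {X Z : C}
    (h : IsSerreDual k (F.obj X) (F.obj Z)) : IsSerreDual k X Z := by
  obtain ⟨η, hη⟩ := h
  refine ⟨η ∘ₗ F.mapLinearMap k, ⟨fun f hf ↦ F.map_injective ?_, fun g hg ↦ F.map_injective ?_⟩⟩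
  · rw [F.map_zero]
    refine hη.left _ fun g ↦ ?_
    obtain ⟨g, rfl⟩ := F.map_surjective g
    simpa using hf g
  · rw [F.map_zero]
    refine hη.right _ fun f ↦ ?_
    obtain ⟨f, rfl⟩ := F.map_surjective f
    simpa using hg f

lemma IsSerreDual.map_of_isEquivalence [F.IsEquivalence] {X Z : C} (h : IsSerreDual k X Z) :
    IsSerreDual k (F.obj X) (F.obj Z) := by
  obtain ⟨η, hη⟩ := h
  obtain ⟨η', h⟩ := exists_dual_map F η
  exact ⟨η', hη.map_of_isEquivalence F h⟩

end Functoriality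

section LinearForms

variable {k : Type w} [Field k] {V W V' : Type*} [AddCommGroup V] [Module k V] [AddCommGroup W]
  [Module k W] [AddCommGroup V'] [Module k V']

lemma exists_dual_comp_eq (L : V →ₗ[k] W) (φ : Module.Dual k V)
    (h : ∀ v, L v = 0 → φ v = 0) : ∃ ψ : Module.Dual k W, ∀ v, ψ (L v) = φ v := by
  have : φ ∈ LinearMap.range L.dualMap := by
    rw [LinearMap.range_dualMap_eq_dualAnnihilator_ker, Submodule.mem_dualAnnihilator]
    exact h
  obtain ⟨ψ, rfl⟩ := this
  exact ⟨ψ, fun _ ↦ rfl⟩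

/-- Forms given on two subspaces glue as soon as they agree on the overlap. This produces the trace
on the middle term of a triangle. -/
lemma exists_dual_comp_eq₂ (L : V →ₗ[k] W) (L' : V' →ₗ[k] W) (φ : Module.Dual k V)
    (φ' : Module.Dual k V') (h : ∀ v v', L v = L' v' → φ v = φ' v') :
    ∃ ψ : Module.Dual k W, (∀ v, ψ (L v) = φ v) ∧ ∀ v, ψ (L' v) = φ' v := by
  obtain ⟨ψ, hψ⟩ := exists_dual_comp_eq (L.coprod L') (φ.coprod φ') (by
    rintro ⟨v, v'⟩ hv
    have := h v (-v') (by simpa [eq_neg_iff_add_eq_zero] using hv)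
    simp [this])
  exact ⟨ψ, fun v ↦ by simpa using hψ (v, 0), fun v ↦ by simpa using hψ (0, v)⟩

end LinearForms

section Shift

variable {k : Type w} [Field k] {C : Type u} [Category.{v} C] [Preadditive C] [Linear k C]
  [HasShift C ℤ] [∀ n : ℤ, (shiftFunctor C n).Additive] [∀ n : ℤ, (shiftFunctor C n).Linear k]

lemma IsSerreDual.shift {X Z : C} (h : IsSerreDual k X Z) (n : ℤ) :
    IsSerreDual k (X⟦n⟧) (Z⟦n⟧) :=
  h.map_of_isEquivalence (shiftFunctor C n)

end Shift

section Triangulated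

variable {k : Type w} [Field k] {C : Type u} [Category.{v} C] [Preadditive C] [Linear k C]
  [HasShift C ℤ] [∀ n : ℤ, (shiftFunctor C n).Additive]

variable [HasZeroObject C] [Pretriangulated C] [∀ X Y : C, FiniteDimensional k (X ⟶ Y)]

/-- The trace on `X ⟶ Z` is prescribed on maps through `j` by `η'` and on maps through `p` by `η''`;
`hw`, the adjointness of the connecting maps, makes the prescriptions agree. Nondegeneracy follows
by a diagram chase. The sign in `hw` compensates the sign in the rotated triangle. -/
lemma IsSerreTrace.isSerreDual_of_distinguished {X' X X'' Z' Z Z'' : C}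
    {η' : Module.Dual k (X' ⟶ Z')} {η'' : Module.Dual k (X'' ⟶ Z'')}
    {η₁ : Module.Dual k (X'⟦(1 : ℤ)⟧ ⟶ Z'⟦(1 : ℤ)⟧)}
    (hη' : IsSerreTrace η') (hη'' : IsSerreTrace η'') (hη₁ : IsSerreTrace η₁)
    (h₁ : ∀ x : X' ⟶ Z', η₁ (x⟦(1 : ℤ)⟧') = η' x)
    {u : X' ⟶ X} {p : X ⟶ X''} {w : X'' ⟶ X'⟦(1 : ℤ)⟧} (hT : Triangle.mk u p w ∈ distTriang C)
    {j : Z' ⟶ Z} {q : Z ⟶ Z''} {w' : Z'' ⟶ Z'⟦(1 : ℤ)⟧} (hT' : Triangle.mk j q w' ∈ distTriang C)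
    (hw : ∀ h : X'⟦(1 : ℤ)⟧ ⟶ Z'', η'' (w ≫ h) = - η₁ (h ≫ w')) : IsSerreDual k X Z := by
  have hpw : p ≫ w = 0 := comp_distTriang_mor_zero₂₃ _ hT
  have hqw : q ≫ w' = 0 := comp_distTriang_mor_zero₂₃ _ hT'
  have hwj : w' ≫ j⟦(1 : ℤ)⟧' = 0 := comp_distTriang_mor_zero₃₁ _ hT'
  obtain ⟨η, hηj, hηp⟩ := exists_dual_comp_eq₂ (Linear.rightComp k X j) (Linear.leftComp k Z p)
    (η' ∘ₗ Linear.leftComp k Z' u) (η'' ∘ₗ Linear.rightComp k X'' q) (by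
      intro f g hfg
      -- An element of the overlap is a commutative square; completing it to a morphism of triangles
      -- expresses both values through the same `c`.
      obtain ⟨c, hc₁, hc₂⟩ : ∃ c : X'⟦(1 : ℤ)⟧ ⟶ Z'', w ≫ c = g ≫ q ∧
          (-u⟦(1 : ℤ)⟧') ≫ f⟦(1 : ℤ)⟧' = c ≫ w' :=
        complete_distinguished_triangle_morphism _ _ (rot_of_distTriang _ hT) hT' f g hfg.symm
      change η' (u ≫ f) = η'' (g ≫ q)
      rw [← hc₁, hw, ← hc₂, Preadditive.neg_comp, ← Functor.map_comp, map_neg, neg_neg, h₁])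
  simp only [Linear.rightComp_apply, Linear.leftComp_apply, LinearMap.comp_apply] at hηj hηp
  refine ⟨η, ⟨fun {Y} f hf ↦ ?_, fun {Y} g hg ↦ ?_⟩⟩
  · have huf : u ≫ f = 0 := hη'.left _ fun g ↦ by
      rw [Category.assoc, ← hηj, Category.assoc, hf]
    obtain ⟨f', rfl⟩ : ∃ f' : X'' ⟶ Y, f = p ≫ f' := Triangle.yoneda_exact₂ _ hT f huf
    -- The form `η''(f' ≫ -)` kills the maps that lift to `Z`, so it depends only on the composite
    -- with `w'`. Representing it by some `h` forces `f'` to factor through `w`, and `p ≫ w = 0`.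
    obtain ⟨φ, hφ⟩ := exists_dual_comp_eq (Linear.rightComp k Y w')
      (η'' ∘ₗ Linear.leftComp k Z'' f') (fun g hg ↦ by
        obtain ⟨g', rfl⟩ : ∃ g' : Y ⟶ Z, g = g' ≫ q := Triangle.coyoneda_exact₃ _ hT' g hg
        change η'' (f' ≫ g' ≫ q) = 0
        rw [← Category.assoc, ← hηp, ← Category.assoc]
        exact hf g')
    obtain ⟨h, hh⟩ := hη₁.exists_left φ
    have : f' = w ≫ (-h) := hη''.left_ext fun g ↦ by
      rw [Category.assoc, hw, Preadditive.neg_comp, Preadditive.neg_comp, map_neg, neg_neg,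
        Category.assoc, hh]
      exact (hφ g).symm
    rw [this, ← Category.assoc, hpw, zero_comp]
  · have hgq : g ≫ q = 0 := hη''.right _ fun f ↦ by
      rw [← Category.assoc, ← hηp, ← Category.assoc, hg]
    obtain ⟨g', rfl⟩ : ∃ g' : Y ⟶ Z', g = g' ≫ j := Triangle.coyoneda_exact₂ _ hT' g hgq
    obtain ⟨φ, hφ⟩ := exists_dual_comp_eq (Linear.leftComp k (Y⟦(1 : ℤ)⟧) w)
      (η₁ ∘ₗ Linear.rightComp k (X'⟦(1 : ℤ)⟧) (g'⟦(1 : ℤ)⟧')) (fun x hx ↦ by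
        obtain ⟨y, hy⟩ : ∃ y : X⟦(1 : ℤ)⟧ ⟶ Y⟦(1 : ℤ)⟧, x = (-u⟦(1 : ℤ)⟧') ≫ y :=
          Triangle.yoneda_exact₃ _ (rot_of_distTriang _ hT) x hx
        obtain ⟨y, rfl⟩ := (shiftFunctor C (1 : ℤ)).map_surjective y
        change η₁ (x ≫ g'⟦(1 : ℤ)⟧') = 0
        rw [hy, Preadditive.neg_comp, Preadditive.neg_comp, ← Functor.map_comp,
          ← Functor.map_comp, map_neg, h₁, Category.assoc, ← hηj, Category.assoc, hg, neg_zero])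
    obtain ⟨h, hh⟩ := hη''.exists_right φ
    have : g'⟦(1 : ℤ)⟧' = -h ≫ w' := hη₁.right_ext fun x ↦ by
      rw [Preadditive.comp_neg, map_neg, ← Category.assoc, ← hw, ← Category.assoc, hh]
      exact (hφ x).symm
    have : (g' ≫ j)⟦(1 : ℤ)⟧' = 0 := by
      rw [Functor.map_comp, this, Preadditive.neg_comp, Category.assoc, hwj, comp_zero, neg_zero]
    exact (shiftFunctor C (1 : ℤ)).map_injective (this.trans (Functor.map_zero _ _ _).symm)

variable [∀ n : ℤ, (shiftFunctor C n).Linear k]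

/-- The connecting map has an adjoint, up to sign, between the partners of the outer terms; the
triangle completed on this adjoint has the required partner in the middle. -/
lemma exists_isSerreDual_left_of_distinguished {T : Triangle C} (hT : T ∈ distTriang C)
    (h₁ : ∃ Z, IsSerreDual k T.obj₁ Z) (h₃ : ∃ Z, IsSerreDual k T.obj₃ Z) :
    ∃ Z, IsSerreDual k T.obj₂ Z := by
  obtain ⟨Z', η', hη'⟩ := h₁
  obtain ⟨Z'', η'', hη''⟩ := h₃
  obtain ⟨η₁, h₁⟩ := exists_dual_map (shiftFunctor C (1 : ℤ)) η'
  have hη₁ := hη'.map_of_isEquivalence _ h₁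
  obtain ⟨w', hw'⟩ := hη₁.exists_right (-(η'' ∘ₗ Linear.leftComp k Z'' T.mor₃))
  obtain ⟨Z, j, q, hT'⟩ := distinguished_cocone_triangle₂ w'
  exact ⟨Z, hη'.isSerreDual_of_distinguished hη'' hη₁ h₁ hT hT' fun h ↦ by simp [hw']⟩

lemma exists_isSerreDual_right_of_distinguished {T : Triangle C} (hT : T ∈ distTriang C)
    (h₁ : ∃ X, IsSerreDual k X T.obj₁) (h₃ : ∃ X, IsSerreDual k X T.obj₃) :
    ∃ X, IsSerreDual k X T.obj₂ := by
  obtain ⟨X', η', hη'⟩ := h₁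
  obtain ⟨X'', η'', hη''⟩ := h₃
  obtain ⟨η₁, h₁⟩ := exists_dual_map (shiftFunctor C (1 : ℤ)) η'
  have hη₁ := hη'.map_of_isEquivalence _ h₁
  obtain ⟨w, hw⟩ := hη''.exists_left (-(η₁ ∘ₗ Linear.rightComp k (X'⟦(1 : ℤ)⟧) T.mor₃))
  obtain ⟨X, u, p, hT'⟩ := distinguished_cocone_triangle₂ w
  exact ⟨X, hη'.isSerreDual_of_distinguished hη'' hη₁ h₁ hT' hT fun h ↦ by simp [hw]⟩

end Triangulated

end FiniteVariety

namespace FiniteVariety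

open Limits Pretriangulated DerivedCategory

/-! ### The bounded derived category -/

section BoundedDerivedCategory

universe w'

variable {k : Type w} [Field k] {A : Type u} [Category.{v} A] [Abelian A]
  [HasDerivedCategory.{w'} A]

variable (A) in
/-- The inclusion of the bounded derived category in the derived category. -/
noncomputable abbrev boundedι : BoundedDerivedCategory A ⥤ DerivedCategory A :=
  (TStructure.t (C := A)).bounded.ι

variable (A) in
/-- The canonical t-structure of the bounded derived category. -/
noncomputable def boundedTStructure : Triangulated.TStructure (BoundedDerivedCategory A) :=
  (TStructure.t (C := A)).bounded.tStructure TStructure.t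

variable (A) in
/-- The inclusion of an abelian category in its bounded derived category. -/
noncomputable def boundedSingle : A ⥤ BoundedDerivedCategory A :=
  (TStructure.t (C := A)).bounded.lift (singleFunctor A 0)
    fun _ ↦ ⟨⟨0, inferInstance⟩, ⟨0, inferInstance⟩⟩

instance (n : ℤ) [Linear k A] : (shiftFunctor (BoundedDerivedCategory A) n).Linear k where
  map_smul {X Y} f r := by
    apply (boundedι A).map_injective
    have h := ((boundedι A).commShiftIso n).hom.naturality
    rw [← cancel_mono (((boundedι A).commShiftIso n).hom.app Y)]
    rw [Functor.map_smul (boundedι A), Linear.smul_comp]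
    have h₁ := h (r • f)
    have h₂ := h f
    dsimp only [Functor.comp_map] at h₁ h₂
    rw [h₁, h₂, Functor.map_smul (boundedι A), Functor.map_smul (shiftFunctor _ n),
      Linear.comp_smul]

instance : (boundedSingle A).Full := by
  have : (boundedSingle A ⋙ boundedι A).Full := inferInstanceAs (singleFunctor A 0).Full
  exact Functor.Full.of_comp_faithful (boundedSingle A) (boundedι A)

instance : (boundedSingle A).Faithful := by
  have : (boundedSingle A ⋙ boundedι A).Faithful := inferInstanceAs (singleFunctor A 0).Faithful
  exact Functor.Faithful.of_comp (boundedSingle A) (boundedι A)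

instance : (boundedSingle A).Additive where
  map_add := by
    intros
    apply (boundedι A).map_injective
    exact (singleFunctor A 0).map_add

instance [Linear k A] : (boundedSingle A).Linear k where
  map_smul f r := by
    apply (boundedι A).map_injective
    exact Functor.map_smul (singleFunctor A 0) r f

instance (M : A) : (boundedTStructure A).IsLE ((boundedSingle A).obj M) 0 := by
  unfold boundedTStructure
  rw [ObjectProperty.tStructure_isLE_iff]
  exact inferInstanceAs (((singleFunctor A 0).obj M).IsLE 0)

instance (M : A) : (boundedTStructure A).IsGE ((boundedSingle A).obj M) 0 := by
  unfold boundedTStructure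
  rw [ObjectProperty.tStructure_isGE_iff]
  exact inferInstanceAs (((singleFunctor A 0).obj M).IsGE 0)

lemma exists_isGE_boundedTStructure (X : BoundedDerivedCategory A) :
    ∃ n, (boundedTStructure A).IsGE X n := by
  obtain ⟨n, hn⟩ := X.property.1
  exact ⟨n, by unfold boundedTStructure; rwa [ObjectProperty.tStructure_isGE_iff]⟩

lemma exists_isLE_boundedTStructure (X : BoundedDerivedCategory A) :
    ∃ n, (boundedTStructure A).IsLE X n := by
  obtain ⟨n, hn⟩ := X.property.2
  exact ⟨n, by unfold boundedTStructure; rwa [ObjectProperty.tStructure_isLE_iff]⟩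

lemma exists_iso_boundedSingle (X : BoundedDerivedCategory A)
    [hX : (boundedTStructure A).IsGE X 0] [hX' : (boundedTStructure A).IsLE X 0] :
    ∃ M : A, Nonempty (X ≅ (boundedSingle A).obj M) := by
  unfold boundedTStructure at hX hX'
  rw [ObjectProperty.tStructure_isGE_iff] at hX
  rw [ObjectProperty.tStructure_isLE_iff] at hX'
  obtain ⟨M, ⟨e⟩⟩ := exists_iso_singleFunctor_obj_of_isGE_of_isLE X.obj 0
  exact ⟨M, ⟨ObjectProperty.isoMk _ e⟩⟩

lemma exists_boundedSingle_distinguished {S : ShortComplex A} (hS : S.ShortExact) :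
    ∃ δ, Triangle.mk ((boundedSingle A).map S.f) ((boundedSingle A).map S.g) δ ∈
      distTriang (BoundedDerivedCategory A) := by
  let e := ((boundedι A).commShiftIso (1 : ℤ)).app ((boundedSingle A).obj S.X₁)
  refine ⟨ObjectProperty.homMk (hS.singleδ ≫ e.inv), ?_⟩
  change (boundedι A).mapTriangle.obj _ ∈ distTriang _
  refine isomorphic_distinguished _ hS.singleTriangle_distinguished _
    (Triangle.isoMk _ _ (Iso.refl _) (Iso.refl _) (Iso.refl _) ?_ ?_ ?_)
  · exact (Category.comp_id _).trans (Category.id_comp _).symm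
  · exact (Category.comp_id _).trans (Category.id_comp _).symm
  · change ((hS.singleδ ≫ e.inv) ≫ e.hom) ≫ (shiftFunctor _ (1 : ℤ)).map (𝟙 _) = 𝟙 _ ≫ hS.singleδ
    refine (congrArg (_ ≫ ·) ((shiftFunctor (DerivedCategory A) (1 : ℤ)).map_id _)).trans
      ((Category.comp_id _).trans ?_)
    refine ((Category.assoc _ _ _).trans ((congrArg (hS.singleδ ≫ ·) e.inv_hom_id).trans ?_))
    exact (Category.comp_id _).trans (Category.id_comp _).symm

lemma boundedSingle_hom_eq_zero_of_projective {P : A} [Projective P]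
    {Y : BoundedDerivedCategory A} [hY : (boundedTStructure A).IsLE Y (-1)]
    (f : (boundedSingle A).obj P ⟶ Y) : f = 0 := by
  unfold boundedTStructure at hY
  rw [ObjectProperty.tStructure_isLE_iff] at hY
  obtain ⟨K, hK, ⟨e⟩⟩ := Y.obj.exists_iso_Q_obj_of_isLE (-1)
  apply (boundedι A).map_injective
  rw [Functor.map_zero, ← cancel_mono e.hom, zero_comp]
  exact from_singleFunctor_obj_eq_zero_of_projective (L := K) (i := 0) (f.hom ≫ e.hom) (-1)
    (by lia)

lemma boundedSingle_hom_eq_zero_of_injective {I : A} [Injective I]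
    {Y : BoundedDerivedCategory A} [hY : (boundedTStructure A).IsGE Y 1]
    (f : Y ⟶ (boundedSingle A).obj I) : f = 0 := by
  unfold boundedTStructure at hY
  rw [ObjectProperty.tStructure_isGE_iff] at hY
  obtain ⟨K, hK, ⟨e⟩⟩ := Y.obj.exists_iso_Q_obj_of_isGE 1
  apply (boundedι A).map_injective
  rw [Functor.map_zero, ← cancel_epi e.inv, comp_zero]
  exact to_singleFunctor_obj_eq_zero_of_injective (K := K) (i := 0) (e.inv ≫ f.hom) 1
    (by lia)

/-- Translates vanishing of Ext groups, by which homological dimensions are tested, into vanishing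
in the bounded derived category. -/
lemma boundedSingle_shift_hom_eq_zero_iff {M N : A} (n : ℕ) :
    letI := HasExt.standard A
    (∀ f : (boundedSingle A).obj M ⟶ ((boundedSingle A).obj N)⟦(n : ℤ)⟧, f = 0) ↔
      ∀ e : Abelian.Ext M N n, e = 0 := by
  let := HasExt.standard A
  let i : (((boundedSingle A).obj N)⟦(n : ℤ)⟧).obj ≅ ((singleFunctor A 0).obj N)⟦(n : ℤ)⟧ :=
    ((boundedι A).commShiftIso (n : ℤ)).app ((boundedSingle A).obj N)
  constructor
  · intro h e
    refine Abelian.Ext.ext (?_ : e.hom = (0 : Abelian.Ext M N n).hom)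
    rw [Abelian.Ext.zero_hom, ← cancel_mono i.inv, zero_comp]
    exact congrArg (boundedι A).map (h (ObjectProperty.homMk (e.hom ≫ i.inv)))
  · intro h f
    apply (boundedι A).map_injective
    rw [Functor.map_zero, ← cancel_mono i.hom, zero_comp]
    have := congrArg Abelian.Ext.hom (h (Abelian.Ext.homEquiv.symm (f.hom ≫ i.hom)))
    rw [Abelian.Ext.zero_hom] at this
    exact (Abelian.Ext.homEquiv.apply_symm_apply (f.hom ≫ i.hom)).symm.trans this

lemma hasProjectiveDimensionLT_iff_boundedSingle (M : A) (n : ℕ) :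
    HasProjectiveDimensionLT M n ↔ ∀ (i : ℕ), n ≤ i → ∀ (N : A)
      (f : (boundedSingle A).obj M ⟶ ((boundedSingle A).obj N)⟦(i : ℤ)⟧), f = 0 := by
  let := HasExt.standard A
  rw [hasProjectiveDimensionLT_iff]
  exact forall₃_congr fun i _ N ↦ (boundedSingle_shift_hom_eq_zero_iff i).symm

lemma hasInjectiveDimensionLT_iff_boundedSingle (N : A) (n : ℕ) :
    HasInjectiveDimensionLT N n ↔ ∀ (i : ℕ), n ≤ i → ∀ (M : A)
      (f : (boundedSingle A).obj M ⟶ ((boundedSingle A).obj N)⟦(i : ℤ)⟧), f = 0 := by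
  let := HasExt.standard A
  rw [hasInjectiveDimensionLT_iff]
  exact forall₃_congr fun i _ N ↦ (boundedSingle_shift_hom_eq_zero_iff i).symm

end BoundedDerivedCategory

end FiniteVariety

namespace FiniteVariety

open Limits Pretriangulated DerivedCategory

/-! ### Dévissage: from modules and resolutions to bounded complexes -/

section Devissage

universe w'

variable {k : Type w} [Field k] {A : Type u} [Category.{v} A] [Abelian A]
  [HasDerivedCategory.{w'} A]

instance isLE_boundedSingle_shift (M : A) (n : ℤ) :
    (boundedTStructure A).IsLE (((boundedSingle A).obj M)⟦n⟧) (-n) :=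
  (boundedTStructure A).isLE_shift _ 0 n (-n)

instance isGE_boundedSingle_shift (M : A) (n : ℤ) :
    (boundedTStructure A).IsGE (((boundedSingle A).obj M)⟦n⟧) (-n) :=
  (boundedTStructure A).isGE_shift _ 0 n (-n)

lemma exists_iso_boundedSingle_shift (X : BoundedDerivedCategory A) (n : ℤ)
    [(boundedTStructure A).IsGE X n]
    [(boundedTStructure A).IsLE X n] : ∃ M : A, Nonempty (X ≅ ((boundedSingle A).obj M)⟦-n⟧) := by
  have := (boundedTStructure A).isGE_shift X n n 0
  have := (boundedTStructure A).isLE_shift X n n 0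
  obtain ⟨M, ⟨e⟩⟩ := exists_iso_boundedSingle (X⟦n⟧)
  exact ⟨M, ⟨(shiftEquiv _ n).unitIso.app X ≪≫ (shiftFunctor _ (-n)).mapIso e⟩⟩

/-- Induction on the amplitude: each step splits off the lowest cohomology object by a truncation
triangle. No closure under shifts is needed, which allows its use for orthogonality conditions. -/
lemma prop_of_isLE (Q : ObjectProperty (BoundedDerivedCategory A)) [Q.IsClosedUnderIsomorphisms]
    [Q.IsTriangulatedClosed₂] (b : ℤ) (h : ∀ i ≤ b, ∀ M, Q (((boundedSingle A).obj M)⟦-i⟧))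
    (X : BoundedDerivedCategory A) [(boundedTStructure A).IsLE X b] : Q X := by
  have key (n : ℕ) : ∀ (X : BoundedDerivedCategory A), (boundedTStructure A).IsGE X (b - n) →
      (boundedTStructure A).IsLE X b → Q X := by
    induction n with
    | zero =>
      intro X hX hX'
      simp only [Nat.cast_zero, sub_zero] at hX
      obtain ⟨M, ⟨e⟩⟩ := exists_iso_boundedSingle_shift X b
      exact Q.prop_of_iso e.symm (h b le_rfl M)
    | succ n ih =>
      intro X hX hX'
      push_cast at hX
      have hT := (boundedTStructure A).triangleLEGE_distinguished (b - (n + 1)) (b - n) (by lia) X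
      refine Q.ext_of_isTriangulatedClosed₂ _ hT ?_ ?_
      · obtain ⟨M, ⟨e⟩⟩ := exists_iso_boundedSingle_shift
          (((boundedTStructure A).truncLE (b - (n + 1))).obj X) (b - (n + 1))
        exact Q.prop_of_iso e.symm (h _ (by lia) M)
      · exact ih (((boundedTStructure A).truncGE (b - n)).obj X) inferInstance inferInstance
  obtain ⟨a, ha⟩ := exists_isGE_boundedTStructure X
  exact key (b - a).toNat X ((boundedTStructure A).isGE_of_ge X _ a (by lia)) inferInstance

lemma prop_of_boundedSingle (Q : ObjectProperty (BoundedDerivedCategory A))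
    [Q.IsClosedUnderIsomorphisms] [Q.IsTriangulatedClosed₂] [Q.IsStableUnderShift ℤ]
    (h : ∀ M, Q ((boundedSingle A).obj M)) (X : BoundedDerivedCategory A) : Q X := by
  obtain ⟨b, hb⟩ := exists_isLE_boundedTStructure X
  exact prop_of_isLE Q b (fun i _ M ↦ Q.le_shift _ _ (h M)) X

lemma prop_boundedSingle_of_projective (Q : ObjectProperty (BoundedDerivedCategory A))
    [Q.IsClosedUnderIsomorphisms] [Q.IsTriangulatedClosed₂] [Q.IsStableUnderShift ℤ]
    [EnoughProjectives A] (h : ∀ P : A, Projective P → Q ((boundedSingle A).obj P)) (n : ℕ) (M : A)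
    [hM : HasProjectiveDimensionLE M n] : Q ((boundedSingle A).obj M) := by
  induction n generalizing M with
  | zero => exact h M (projective_iff_hasProjectiveDimensionLT_one.2 hM)
  | succ n ih =>
    let S := ShortComplex.mk (kernel.ι (Projective.π M)) (Projective.π M) (kernel.condition _)
    have hS : S.ShortExact :=
      { exact := ShortComplex.exact_of_f_is_kernel _ (kernelIsKernel _)
        mono_f := by dsimp [S]; infer_instance
        epi_g := by dsimp [S]; infer_instance }
    have := (hS.hasProjectiveDimensionLT_X₃_iff n (Projective.projective_over M)).1 hM
    obtain ⟨δ, hδ⟩ := exists_boundedSingle_distinguished hS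
    -- After rotation `M` is the middle term, between its projective cover and the shifted syzygy.
    exact Q.ext_of_isTriangulatedClosed₂ _ (rot_of_distTriang _ hδ)
      (h _ (Projective.projective_over M)) (Q.le_shift (1 : ℤ) _ (ih (kernel (Projective.π M))))

lemma prop_boundedSingle_of_injective (Q : ObjectProperty (BoundedDerivedCategory A))
    [Q.IsClosedUnderIsomorphisms] [Q.IsTriangulatedClosed₂] [Q.IsStableUnderShift ℤ]
    [EnoughInjectives A] (h : ∀ I : A, Injective I → Q ((boundedSingle A).obj I)) (n : ℕ) (M : A)
    [hM : HasInjectiveDimensionLE M n] : Q ((boundedSingle A).obj M) := by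
  induction n generalizing M with
  | zero => exact h M (injective_iff_hasInjectiveDimensionLT_one.2 hM)
  | succ n ih =>
    let S := ShortComplex.mk (Injective.ι M) (cokernel.π (Injective.ι M)) (cokernel.condition _)
    have hS : S.ShortExact :=
      { exact := ShortComplex.exact_of_g_is_cokernel _ (cokernelIsCokernel _)
        mono_f := by dsimp [S]; infer_instance
        epi_g := by dsimp [S]; infer_instance }
    have := (hS.hasInjectiveDimensionLT_X₃_iff n (Injective.injective_under M)).2 hM
    obtain ⟨δ, hδ⟩ := exists_boundedSingle_distinguished hS
    exact Q.ext_of_isTriangulatedClosed₂ _ (inv_rot_of_distTriang _ hδ)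
      (Q.le_shift (-1 : ℤ) _ (ih (cokernel (Injective.ι M)))) (h _ (Injective.injective_under M))

/-! ### Hom-finiteness -/

lemma finiteDimensional_of_exact {k V W U : Type*} [Field k] [AddCommGroup V] [Module k V]
    [AddCommGroup W] [Module k W] [AddCommGroup U] [Module k U] [FiniteDimensional k V]
    [FiniteDimensional k U] (f : V →ₗ[k] W) (g : W →ₗ[k] U)
    (h : ∀ w, g w = 0 → ∃ v, f v = w) : FiniteDimensional k W := by
  have : FiniteDimensional k (LinearMap.ker g) :=
    Submodule.finiteDimensional_of_le (S₂ := LinearMap.range f) fun w hw ↦ h w hw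
  have : FiniteDimensional k (W ⧸ LinearMap.ker g) :=
    Module.Finite.equiv g.quotKerEquivRange.symm
  exact Module.Finite.of_submodule_quotient (LinearMap.ker g)

variable [Linear k A]

lemma finiteDimensional_hom_of_distinguished_left {C : Type*} [Category* C] [Preadditive C]
    [HasZeroObject C] [HasShift C ℤ] [∀ n : ℤ, (shiftFunctor C n).Additive] [Pretriangulated C]
    [Linear k C] {T : Triangle C} (hT : T ∈ distTriang C) (Y : C)
    (_ : FiniteDimensional k (T.obj₁ ⟶ Y)) (_ : FiniteDimensional k (T.obj₃ ⟶ Y)) :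
    FiniteDimensional k (T.obj₂ ⟶ Y) :=
  finiteDimensional_of_exact (Linear.leftComp k Y T.mor₂) (Linear.leftComp k Y T.mor₁) fun f hf ↦ by
    obtain ⟨g, hg⟩ := Triangle.yoneda_exact₂ T hT f hf
    exact ⟨g, hg.symm⟩

lemma finiteDimensional_hom_of_distinguished_right {C : Type*} [Category* C] [Preadditive C]
    [HasZeroObject C] [HasShift C ℤ] [∀ n : ℤ, (shiftFunctor C n).Additive] [Pretriangulated C]
    [Linear k C] {T : Triangle C} (hT : T ∈ distTriang C) (X : C)
    (_ : FiniteDimensional k (X ⟶ T.obj₁)) (_ : FiniteDimensional k (X ⟶ T.obj₃)) :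
    FiniteDimensional k (X ⟶ T.obj₂) :=
  finiteDimensional_of_exact (Linear.rightComp k X T.mor₁) (Linear.rightComp k X T.mor₂)
    fun f hf ↦ by
      obtain ⟨g, hg⟩ := Triangle.coyoneda_exact₂ T hT f hf
      exact ⟨g, hg.symm⟩

lemma boundedSingle_hom_shift_eq_zero_of_projective {P M : A} [Projective P] {n : ℤ} (hn : n ≠ 0)
    (f : (boundedSingle A).obj P ⟶ ((boundedSingle A).obj M)⟦n⟧) : f = 0 := by
  obtain hn | hn := hn.lt_or_gt
  · exact (boundedTStructure A).zero f 0 (-n) (by lia)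
  · have := (boundedTStructure A).isLE_of_le (((boundedSingle A).obj M)⟦n⟧) (-n) (-1) (by lia)
    exact boundedSingle_hom_eq_zero_of_projective f

lemma boundedSingle_shift_hom_eq_zero_of_injective {M I : A} [Injective I] {n : ℤ} (hn : n ≠ 0)
    (f : ((boundedSingle A).obj M)⟦n⟧ ⟶ (boundedSingle A).obj I) : f = 0 := by
  obtain hn | hn := hn.lt_or_gt
  · have := (boundedTStructure A).isGE_of_ge (((boundedSingle A).obj M)⟦n⟧) 1 (-n) (by lia)
    exact boundedSingle_hom_eq_zero_of_injective f
  · exact (boundedTStructure A).zero f (-n) 0 (by lia)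

lemma finiteDimensional_hom_boundedDerivedCategory [EnoughProjectives A]
    (hA : ∀ M N : A, FiniteDimensional k (M ⟶ N))
    (hpd : ∀ M : A, ∃ n, HasProjectiveDimensionLE M n) (X Y : BoundedDerivedCategory A) :
    FiniteDimensional k (X ⟶ Y) := by
  -- All shifts of `Y` are included in the property so that it is stable under shift.
  have h₁ (P : A) (_ : Projective P) (Y : BoundedDerivedCategory A) :
      ∀ n : ℤ, FiniteDimensional k ((boundedSingle A).obj P ⟶ Y⟦n⟧) := by
    let Q : ObjectProperty (BoundedDerivedCategory A) := fun Y ↦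
      ∀ n : ℤ, FiniteDimensional k ((boundedSingle A).obj P ⟶ Y⟦n⟧)
    have : Q.IsClosedUnderIsomorphisms := ⟨fun e h n ↦
      have := h n
      Module.Finite.equiv (Linear.homCongr k (Iso.refl _) ((shiftFunctor _ n).mapIso e))⟩
    have : Q.IsTriangulatedClosed₂ := .mk' fun T hT h₁ h₃ n ↦
      finiteDimensional_hom_of_distinguished_right (Triangle.shift_distinguished _ hT n) _
        (h₁ n) (h₃ n)
    have : Q.IsStableUnderShift ℤ := ⟨fun m ↦ ⟨fun Y h n ↦
      have := h (m + n)
      Module.Finite.equiv (Linear.homCongr k (Iso.refl _) ((shiftFunctorAdd _ m n).app Y))⟩⟩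
    refine prop_of_boundedSingle Q (fun M n ↦ ?_) Y
    obtain rfl | hn := eq_or_ne n 0
    · have := hA P M
      exact Module.Finite.equiv ((homLinearEquiv (boundedSingle A) P M).trans
        (Linear.homCongr k (Iso.refl _) ((shiftFunctorZero _ ℤ).symm.app _)))
    · have : Subsingleton ((boundedSingle A).obj P ⟶ ((boundedSingle A).obj M)⟦n⟧) :=
        ⟨fun f g ↦ (boundedSingle_hom_shift_eq_zero_of_projective hn f).trans
          (boundedSingle_hom_shift_eq_zero_of_projective hn g).symm⟩
      infer_instance
  let Q : ObjectProperty (BoundedDerivedCategory A) := fun X ↦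
    ∀ Y : BoundedDerivedCategory A, FiniteDimensional k (X ⟶ Y)
  have : Q.IsClosedUnderIsomorphisms := ⟨fun e h Y ↦
    have := h Y
    Module.Finite.equiv (Linear.homCongr k e (Iso.refl _))⟩
  have : Q.IsTriangulatedClosed₂ := .mk' fun T hT h₁ h₃ Y ↦
    finiteDimensional_hom_of_distinguished_left hT Y (h₁ Y) (h₃ Y)
  have : Q.IsStableUnderShift ℤ := ⟨fun n ↦ ⟨fun X h Y ↦
    have := h (Y⟦-n⟧)
    have e : (X ⟶ Y⟦-n⟧) ≃ₗ[k] (X⟦n⟧ ⟶ Y) :=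
      (Linear.homCongr k ((shiftEquiv _ n).unitIso.app X : X ≅ X⟦n⟧⟦-n⟧) (Iso.refl _)).trans
      (homLinearEquiv (shiftFunctor _ (-n)) (X⟦n⟧) Y).symm
    Module.Finite.equiv e⟩⟩
  refine prop_of_boundedSingle Q (fun M ↦ ?_) X Y
  obtain ⟨n, hn⟩ := hpd M
  refine prop_boundedSingle_of_projective Q (fun P hP Y ↦ ?_) n M
  have := h₁ P hP Y 0
  exact Module.Finite.equiv (Linear.homCongr k (Iso.refl _) ((shiftFunctorZero _ ℤ).app Y))

/-! ### Existence of Serre duality -/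

/-- A linear form on `X ⟶ Z` is nondegenerate at `Y` if the pairing
`(X ⟶ Y) × (Y ⟶ Z) → k` is nondegenerate. -/
structure IsNondegenerateAt {C : Type*} [Category* C] [Preadditive C] [Linear k C] {X Z : C}
    (η : Module.Dual k (X ⟶ Z)) (Y : C) : Prop where
  left : ∀ (f : X ⟶ Y), (∀ g : Y ⟶ Z, η (f ≫ g) = 0) → f = 0
  right : ∀ (g : Y ⟶ Z), (∀ f : X ⟶ Y, η (f ≫ g) = 0) → g = 0

namespace IsNondegenerateAt

variable {C : Type*} [Category* C] [Preadditive C] [Linear k C] {X Z : C}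
    {η : Module.Dual k (X ⟶ Z)}

lemma of_iso {Y Y' : C} (h : IsNondegenerateAt η Y) (e : Y ≅ Y') : IsNondegenerateAt η Y' where
  left f hf := by
    rw [← cancel_mono e.inv, zero_comp]
    exact h.left _ fun g ↦ by simpa using hf (e.inv ≫ g)
  right g hg := by
    rw [← cancel_epi e.hom, comp_zero]
    exact h.right _ fun f ↦ by simpa using hg (f ≫ e.hom)

lemma exists_left {Y : C} (h : IsNondegenerateAt η Y) [FiniteDimensional k (Y ⟶ Z)]
    (φ : Module.Dual k (Y ⟶ Z)) : ∃ f : X ⟶ Y, ∀ g, η (f ≫ g) = φ g := by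
  have : Function.Injective (tracePairing η Y).flip := by
    rw [injective_iff_map_eq_zero]
    exact fun g hg ↦ h.right g fun f ↦ DFunLike.congr_fun hg f
  obtain ⟨f, hf⟩ := LinearMap.flip_injective_iff₂.1 this φ
  exact ⟨f, fun g ↦ DFunLike.congr_fun hf g⟩

lemma exists_right {Y : C} (h : IsNondegenerateAt η Y) [FiniteDimensional k (X ⟶ Y)]
    (φ : Module.Dual k (X ⟶ Y)) : ∃ g : Y ⟶ Z, ∀ f, η (f ≫ g) = φ f := by
  have : Function.Injective (tracePairing η Y) := by
    rw [injective_iff_map_eq_zero]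
    exact fun f hf ↦ h.left f fun g ↦ DFunLike.congr_fun hf g
  obtain ⟨g, hg⟩ := (LinearMap.flip_injective_iff₂ (B := (tracePairing η Y).flip)).1 this φ
  exact ⟨g, fun f ↦ DFunLike.congr_fun hg f⟩

/-- A five lemma for the comparison of `Hom(X, -)` with the dual of `Hom(-, Z)`. The two shifted
hypotheses supply the outer terms of the exact sequences. -/
lemma of_distinguished [HasZeroObject C] [HasShift C ℤ] [∀ n : ℤ, (shiftFunctor C n).Additive]
    [Pretriangulated C] [∀ X Y : C, FiniteDimensional k (X ⟶ Y)] {T : Triangle C}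
    (hT : T ∈ distTriang C) (h₁ : IsNondegenerateAt η T.obj₁)
    (h₁' : IsNondegenerateAt η (T.obj₁⟦(1 : ℤ)⟧)) (h₃ : IsNondegenerateAt η T.obj₃)
    (h₃' : IsNondegenerateAt η (T.obj₃⟦(-1 : ℤ)⟧)) : IsNondegenerateAt η T.obj₂ where
  left f hf := by
    have hf' : f ≫ T.mor₂ = 0 := h₃.left _ fun g ↦ by rw [Category.assoc, hf]
    obtain ⟨f', rfl⟩ := Triangle.coyoneda_exact₂ T hT f hf'
    obtain ⟨δ, hδ, hδ'⟩ : ∃ δ : T.obj₃⟦(-1 : ℤ)⟧ ⟶ T.obj₁, δ ≫ T.mor₁ = 0 ∧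
        ∀ g : T.obj₁ ⟶ Z, δ ≫ g = 0 → ∃ g', g = T.mor₁ ≫ g' :=
      ⟨T.invRotate.mor₁, comp_distTriang_mor_zero₁₂ _ (inv_rot_of_distTriang _ hT),
        Triangle.yoneda_exact₂ _ (inv_rot_of_distTriang _ hT)⟩
    obtain ⟨φ, hφ⟩ := exists_dual_comp_eq (Linear.leftComp k Z δ)
      (η ∘ₗ Linear.leftComp k Z f') (fun g hg ↦ by
        obtain ⟨g', rfl⟩ := hδ' g hg
        exact (congrArg η (Category.assoc _ _ _)).symm.trans (hf g'))
    obtain ⟨h, hh⟩ := h₃'.exists_left φ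
    have : f' = h ≫ δ := by
      rw [← sub_eq_zero]
      refine h₁.left _ fun g ↦ ?_
      rw [Preadditive.sub_comp, map_sub, sub_eq_zero, Category.assoc, hh]
      exact (hφ g).symm
    rw [this, Category.assoc, hδ, comp_zero]
  right g hg := by
    have hg' : T.mor₁ ≫ g = 0 := h₁.right _ fun f ↦ by rw [← Category.assoc, hg]
    obtain ⟨g', rfl⟩ := Triangle.yoneda_exact₂ T hT g hg'
    obtain ⟨φ, hφ⟩ := exists_dual_comp_eq (Linear.rightComp k X T.mor₃)
      (η ∘ₗ Linear.rightComp k X g') (fun f hf ↦ by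
        obtain ⟨f', rfl⟩ := Triangle.coyoneda_exact₃ _ hT f hf
        exact (congrArg η (Category.assoc _ _ _)).trans (hg f'))
    obtain ⟨h, hh⟩ := h₁'.exists_right φ
    have : g' = T.mor₃ ≫ h := by
      rw [← sub_eq_zero]
      refine h₃.right _ fun f ↦ ?_
      rw [Preadditive.comp_sub, map_sub, sub_eq_zero, ← Category.assoc, hh]
      exact (hφ f).symm
    rw [this, ← Category.assoc, comp_distTriang_mor_zero₂₃ _ hT, zero_comp]

end IsNondegenerateAt

/-- Nondegeneracy need only be tested on shifted modules. In degree zero it is the hypothesis; in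
other degrees both Hom spaces vanish, `P` being projective and `I` injective. -/
lemma IsSerreDual.boundedSingle [∀ X Y : BoundedDerivedCategory A, FiniteDimensional k (X ⟶ Y)]
    [∀ X Y : A, FiniteDimensional k (X ⟶ Y)] {P I : A} (h : IsSerreDual k P I) :
    IsSerreDual k ((boundedSingle A).obj P) ((boundedSingle A).obj I) := by
  have := h.projective
  have := h.injective
  obtain ⟨η, hη⟩ := h
  obtain ⟨η', hη'⟩ := exists_dual_map (FiniteVariety.boundedSingle A) η
  let Q : ObjectProperty (BoundedDerivedCategory A) := fun Y ↦
    ∀ n : ℤ, IsNondegenerateAt η' (Y⟦n⟧)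
  have : Q.IsClosedUnderIsomorphisms := ⟨fun e h n ↦ (h n).of_iso ((shiftFunctor _ n).mapIso e)⟩
  have : Q.IsTriangulatedClosed₂ := .mk' fun T hT h₁ h₃ n ↦
    IsNondegenerateAt.of_distinguished (Triangle.shift_distinguished _ hT n) (h₁ n)
      ((h₁ (n + 1)).of_iso ((shiftFunctorAdd _ _ _).app _)) (h₃ n)
      ((h₃ (n + (-1))).of_iso ((shiftFunctorAdd _ _ _).app _))
  have : Q.IsStableUnderShift ℤ := ⟨fun m ↦ ⟨fun Y h n ↦
    (h (m + n)).of_iso ((shiftFunctorAdd _ m n).app Y)⟩⟩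
  have hQ : ∀ Y, Q Y := prop_of_boundedSingle Q fun M n ↦ by
    obtain rfl | hn := eq_or_ne n 0
    · refine IsNondegenerateAt.of_iso (Y := (FiniteVariety.boundedSingle A).obj M)
        ⟨fun f hf ↦ ?_, fun g hg ↦ ?_⟩ ((shiftFunctorZero _ ℤ).symm.app _)
      · obtain ⟨f, rfl⟩ := (FiniteVariety.boundedSingle A).map_surjective f
        rw [hη.left f fun g ↦ by rw [← hη', Functor.map_comp, hf], Functor.map_zero]
      · obtain ⟨g, rfl⟩ := (FiniteVariety.boundedSingle A).map_surjective g
        rw [hη.right g fun f ↦ by rw [← hη', Functor.map_comp, hg], Functor.map_zero]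
    · exact ⟨fun f _ ↦ boundedSingle_hom_shift_eq_zero_of_projective hn f,
        fun g _ ↦ boundedSingle_shift_hom_eq_zero_of_injective hn g⟩
  have hη'' (Y : BoundedDerivedCategory A) : IsNondegenerateAt η' Y :=
    (hQ Y 0).of_iso ((shiftFunctorZero _ ℤ).app Y)
  exact ⟨η', ⟨fun f ↦ (hη'' _).left f, fun g ↦ (hη'' _).right g⟩⟩

theorem hasSerreDuality_boundedDerivedCategory [EnoughProjectives A] [EnoughInjectives A]
    [∀ X Y : A, FiniteDimensional k (X ⟶ Y)] (hA : ObjectsHaveFiniteDimensions A)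
    (h₁ : ∀ P : A, Projective P → ∃ I, IsSerreDual k P I)
    (h₂ : ∀ I : A, Injective I → ∃ P, IsSerreDual k P I) :
    HasSerreDuality k (BoundedDerivedCategory A) := by
  have : ∀ X Y : BoundedDerivedCategory A, FiniteDimensional k (X ⟶ Y) :=
    finiteDimensional_hom_boundedDerivedCategory inferInstance fun M ↦ (hA M).1
  refine hasSerreDuality_of_isSerreDual (fun X ↦ ?_) (fun Z ↦ ?_)
  · let Q : ObjectProperty (BoundedDerivedCategory A) := fun X ↦ ∃ Z, IsSerreDual k X Z
    have : Q.IsClosedUnderIsomorphisms := ⟨fun e ⟨Z, h⟩ ↦ ⟨Z, h.of_iso e (Iso.refl _)⟩⟩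
    have : Q.IsTriangulatedClosed₂ := .mk' fun T hT ↦ exists_isSerreDual_left_of_distinguished hT
    have : Q.IsStableUnderShift ℤ := ⟨fun n ↦ ⟨fun X ⟨Z, h⟩ ↦ ⟨Z⟦n⟧, h.shift n⟩⟩⟩
    refine prop_of_boundedSingle Q (fun M ↦ ?_) X
    obtain ⟨n, hn⟩ := (hA M).1
    refine prop_boundedSingle_of_projective Q (fun P hP ↦ ?_) n M
    obtain ⟨I, hI⟩ := h₁ P hP
    exact ⟨_, hI.boundedSingle⟩
  · let Q : ObjectProperty (BoundedDerivedCategory A) := fun Z ↦ ∃ X, IsSerreDual k X Z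
    have : Q.IsClosedUnderIsomorphisms := ⟨fun e ⟨Z, h⟩ ↦ ⟨Z, h.of_iso (Iso.refl _) e⟩⟩
    have : Q.IsTriangulatedClosed₂ := .mk' fun T hT ↦ exists_isSerreDual_right_of_distinguished hT
    have : Q.IsStableUnderShift ℤ := ⟨fun n ↦ ⟨fun Z ⟨X, h⟩ ↦ ⟨X⟦n⟧, h.shift n⟩⟩⟩
    refine prop_of_boundedSingle Q (fun M ↦ ?_) Z
    obtain ⟨n, hn⟩ := (hA M).2
    refine prop_boundedSingle_of_injective Q (fun I hI ↦ ?_) n M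
    obtain ⟨P, hP⟩ := h₂ I hI
    exact ⟨_, hP.boundedSingle⟩

end Devissage

end FiniteVariety

namespace FiniteVariety

open Limits Pretriangulated DerivedCategory

/-! ### Detecting degrees with a family of projectives -/

section SerreDualityConsequences

universe w'

variable {A : Type u} [Category.{v} A] [Abelian A]
  [HasDerivedCategory.{w'} A]

lemma boundedSingle_shift_hom_eq_zero_of_projective_of_isLE {P : A} [Projective P] {n m : ℤ}
    (h : m < -n) {Y : BoundedDerivedCategory A} [(boundedTStructure A).IsLE Y m]
    (f : ((boundedSingle A).obj P)⟦n⟧ ⟶ Y) : f = 0 := by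
  have := (boundedTStructure A).isLE_of_le Y m (-n - 1) (by lia)
  have := (boundedTStructure A).isLE_shift Y (-n - 1) (-n) (-1)
  apply (shiftFunctor (BoundedDerivedCategory A) (-n)).map_injective
  let e : (boundedSingle A).obj P ≅ ((boundedSingle A).obj P)⟦n⟧⟦-n⟧ :=
    (shiftEquiv _ n).unitIso.app _
  rw [Functor.map_zero, ← cancel_epi e.hom, comp_zero]
  exact boundedSingle_hom_eq_zero_of_projective _

lemma eq_zero_of_boundedSingle_shift_map_comp_eq_zero {M N : A} (π : N ⟶ M) {n : ℤ}
    {H : BoundedDerivedCategory A} (e : H ≅ ((boundedSingle A).obj M)⟦n⟧)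
    (h : ((boundedSingle A).map π)⟦n⟧' ≫ e.inv = 0) : π = 0 := by
  rw [← cancel_mono e.hom, Category.assoc, e.inv_hom_id, Category.comp_id, zero_comp] at h
  exact (boundedSingle A).map_injective ((shiftFunctor _ n).map_injective (by simpa using h))

lemma isZero_of_iso_boundedSingle_shift {M : A} (hM : IsZero M) {n : ℤ}
    {H : BoundedDerivedCategory A} (e : H ≅ ((boundedSingle A).obj M)⟦n⟧) : IsZero H :=
  (Functor.map_isZero (shiftFunctor _ n) ((boundedSingle A).map_isZero hM)).of_iso e

lemma exists_truncation_triangle (X : BoundedDerivedCategory A) (n₀ n₁ : ℤ) (h : n₀ + 1 = n₁) :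
    ∃ (X₁ X₃ : BoundedDerivedCategory A) (f : X₁ ⟶ X) (g : X ⟶ X₃) (δ : X₃ ⟶ X₁⟦(1 : ℤ)⟧),
      Triangle.mk f g δ ∈ distTriang _ ∧ (boundedTStructure A).IsLE X₁ n₀ ∧
      (boundedTStructure A).IsGE X₃ n₁ ∧
      (∀ m, (boundedTStructure A).IsLE X m → (boundedTStructure A).IsLE X₃ m) ∧
      (∀ m, (boundedTStructure A).IsGE X m → (boundedTStructure A).IsGE X₁ m) ∧
      (IsZero X₃ → (boundedTStructure A).IsLE X n₀) ∧
      (IsZero X₁ → (boundedTStructure A).IsGE X n₁) :=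
  ⟨((boundedTStructure A).truncLE n₀).obj X, ((boundedTStructure A).truncGE n₁).obj X, _, _, _,
    (boundedTStructure A).triangleLEGE_distinguished n₀ n₁ h X, inferInstance, inferInstance,
    fun _ _ ↦ inferInstance, fun _ _ ↦ inferInstance,
    fun h' ↦ ((boundedTStructure A).isLE_iff_isZero_truncGE_obj _ _ h _).2 h',
    fun h' ↦ ((boundedTStructure A).isGE_iff_isZero_truncLE_obj _ _ h _).2 h'⟩

section Cover

variable {ι : Type*} {P : ι → A}

/-- Otherwise a cover of the lowest cohomology object, in some negative degree, would give a nonzero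
map from a shifted `P i` to `Z`. Its composite to `Z` can vanish only by factoring through `Z₃⟦-1⟧`,
which lies in degrees too high. -/
lemma isGE_zero_of_hom_eq_zero
    (hcov : ∀ M, ∃ (i : ι) (f : P i ⟶ M), Epi f)
    (Z : BoundedDerivedCategory A)
    (hZ : ∀ (i : ι) (n : ℤ), n ≠ 0 → ∀ f : ((boundedSingle A).obj (P i))⟦n⟧ ⟶ Z, f = 0) :
    (boundedTStructure A).IsGE Z 0 := by
  obtain ⟨a, ha⟩ := exists_isGE_boundedTStructure Z
  replace ha := (boundedTStructure A).isGE_of_ge Z (-((-a).toNat : ℤ)) a (by lia)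
  generalize (-a).toNat = j at ha
  induction j with
  | zero => simpa using ha
  | succ j ih =>
    refine ih ?_
    push_cast at ha
    obtain ⟨Z₁, Z₃, u, p, δ, hT, hZ₁, hZ₃, -, hZ₁', -, hzero⟩ :=
      exists_truncation_triangle Z (-((j : ℤ) + 1)) (-j) (by lia)
    have := hZ₁' _ ha
    apply hzero
    obtain ⟨M, ⟨e⟩⟩ := exists_iso_boundedSingle_shift Z₁ (-((j : ℤ) + 1))
    obtain ⟨i, π, hπ⟩ := hcov M
    have := (boundedTStructure A).isGE_shift Z₃ (-j) (-1) (-j + 1)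
    obtain ⟨v, f, hf⟩ : ∃ (v : Z₃⟦(-1 : ℤ)⟧ ⟶ Z₁) (f : _ ⟶ Z₃⟦(-1 : ℤ)⟧),
        ((boundedSingle A).map π)⟦-(-((j : ℤ) + 1))⟧' ≫ e.inv = f ≫ v :=
      ⟨_, Triangle.coyoneda_exact₂ _ (inv_rot_of_distTriang _ hT) _ (hZ i _ (by lia) _)⟩
    have hf' : f = 0 := (boundedTStructure A).zero_of_isLE_of_isGE f (-(j + 1)) (-j + 1) (by lia)
      ((boundedTStructure A).isLE_of_le _ (-(-(-((j : ℤ) + 1)))) _ (by lia)) this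
    rw [hf', zero_comp] at hf
    have hπ' := eq_zero_of_boundedSingle_shift_map_comp_eq_zero π e hf
    exact isZero_of_iso_boundedSingle_shift (IsZero.of_epi_eq_zero π hπ') e

/-- A cover of the top cohomology object lifts to `Z`, since the obstruction is a map from a shifted
projective to an object in lower degrees. The lift is zero by hypothesis, hence so is the cover. -/
lemma isLE_zero_of_hom_eq_zero
    (hP : ∀ i, Projective (P i)) (hcov : ∀ M, ∃ (i : ι) (f : P i ⟶ M), Epi f)
    (Z : BoundedDerivedCategory A)
    (hZ : ∀ (i : ι) (n : ℤ), n ≠ 0 → ∀ f : ((boundedSingle A).obj (P i))⟦n⟧ ⟶ Z, f = 0) :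
    (boundedTStructure A).IsLE Z 0 := by
  obtain ⟨b, hb⟩ := exists_isLE_boundedTStructure Z
  replace hb := (boundedTStructure A).isLE_of_le Z b (b.toNat : ℤ) (by lia)
  generalize b.toNat = j at hb
  induction j with
  | zero => exact hb
  | succ j ih =>
    refine ih ?_
    push_cast at hb
    obtain ⟨Z₁, Z₃, u, p, δ, hT, hZ₁, hZ₃, hZ₃', -, hzero, -⟩ :=
      exists_truncation_triangle Z (j : ℤ) (j + 1) rfl
    have := hZ₃' _ hb
    apply hzero
    obtain ⟨M, ⟨e⟩⟩ := exists_iso_boundedSingle_shift Z₃ (j + 1)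
    obtain ⟨i, π, hπ⟩ := hcov M
    have := hP i
    have := (boundedTStructure A).isLE_shift Z₁ j 1 (j - 1)
    obtain ⟨f, hf⟩ : ∃ f : _ ⟶ Z, _ = f ≫ p := Triangle.coyoneda_exact₃ _ hT
      (((boundedSingle A).map π)⟦-((j : ℤ) + 1)⟧' ≫ e.inv)
      (boundedSingle_shift_hom_eq_zero_of_projective_of_isLE (m := j - 1) (by lia)
        (Y := Z₁⟦(1 : ℤ)⟧) _)
    rw [hZ i _ (by lia) f, zero_comp] at hf
    have hπ' := eq_zero_of_boundedSingle_shift_map_comp_eq_zero π e hf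
    exact isZero_of_iso_boundedSingle_shift (IsZero.of_epi_eq_zero π hπ') e

/-- One step of a projective resolution of a complex: a cover of the degree-zero cohomology lifts to
`X`, and its cone has no cohomology in degree zero. -/
lemma exists_projective_cover_triangle
    (hP : ∀ i, Projective (P i)) (hcov : ∀ M, ∃ (i : ι) (f : P i ⟶ M), Epi f)
    (X : BoundedDerivedCategory A)
    [(boundedTStructure A).IsLE X 0] :
    ∃ (i : ι) (X' : BoundedDerivedCategory A) (f : (boundedSingle A).obj (P i) ⟶ X) (g : X ⟶ X')
      (h : X' ⟶ ((boundedSingle A).obj (P i))⟦(1 : ℤ)⟧),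
      Triangle.mk f g h ∈ distTriang _ ∧ (boundedTStructure A).IsLE X' (-1) := by
  obtain ⟨X₁, X₃, u, p, δ', hT, hX₁, hX₃, hX₃', -⟩ := exists_truncation_triangle X (-1) 0 rfl
  have := hX₃' 0 inferInstance
  obtain ⟨M, ⟨e⟩⟩ := exists_iso_boundedSingle X₃
  obtain ⟨i, π, hπ⟩ := hcov M
  have := hP i
  have := (boundedTStructure A).isLE_shift X₁ (-1) 1 (-2)
  have := (boundedTStructure A).isLE_of_le (X₁⟦(1 : ℤ)⟧) (-2) (-1)
  obtain ⟨c, hc⟩ : ∃ c : _ ⟶ X, (boundedSingle A).map π ≫ e.inv = c ≫ p :=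
    Triangle.coyoneda_exact₃ _ hT ((boundedSingle A).map π ≫ e.inv)
      (boundedSingle_hom_eq_zero_of_projective (Y := X₁⟦(1 : ℤ)⟧) _)
  obtain ⟨X', g, h, hT'⟩ := distinguished_cocone_triangle c
  refine ⟨i, X', c, g, h, hT', ?_⟩
  -- The cone is tested against objects in degrees `≥ 0`: a map from it restricts on `X` to one
  -- through `X₃`, which vanishes because the cover is epi.
  rw [(boundedTStructure A).isLE_iff_orthogonal (-1) 0 rfl]
  intro Y f hY
  have hcg : c ≫ g = 0 := comp_distTriang_mor_zero₁₂ _ hT'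
  have hgf : g ≫ f = 0 := by
    obtain ⟨q, hq⟩ : ∃ q : X₃ ⟶ Y, g ≫ f = p ≫ q := Triangle.yoneda_exact₂ _ hT (g ≫ f)
      ((boundedTStructure A).zero_of_isLE_of_isGE (X := X₁) (Y := Y) _ (-1) 0 (by lia) hX₁ hY)
    have hq' : (boundedSingle A).map π ≫ e.inv ≫ q = 0 := by
      rw [reassoc_of% hc, ← hq, reassoc_of% hcg, zero_comp]
    let S := ShortComplex.mk (kernel.ι π) π (kernel.condition _)
    have hS : S.ShortExact :=
      { exact := ShortComplex.exact_of_f_is_kernel _ (kernelIsKernel _)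
        mono_f := by dsimp [S]; infer_instance
        epi_g := by dsimp [S]; infer_instance }
    obtain ⟨δ, hδ⟩ := exists_boundedSingle_distinguished hS
    obtain ⟨r, hr⟩ : ∃ r : ((boundedSingle A).obj (kernel π))⟦(1 : ℤ)⟧ ⟶ Y, e.inv ≫ q = δ ≫ r :=
      Triangle.yoneda_exact₃ _ hδ (e.inv ≫ q) hq'
    have hr' : r = 0 := (boundedTStructure A).zero_of_isLE_of_isGE r (-1) 0 (by lia)
      (isLE_boundedSingle_shift (kernel π) 1) hY
    rw [hr', comp_zero] at hr
    rw [hq, (cancel_epi e.inv).1 (hr.trans comp_zero.symm), comp_zero]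
  obtain ⟨r, hr⟩ : ∃ r : ((boundedSingle A).obj (P i))⟦(1 : ℤ)⟧ ⟶ Y, f = h ≫ r :=
    Triangle.yoneda_exact₃ _ hT' f hgf
  have hr' : r = 0 := (boundedTStructure A).zero_of_isLE_of_isGE r (-1) 0 (by lia)
      (isLE_boundedSingle_shift (P i) 1) hY
  rw [hr, hr', comp_zero]

end Cover

end SerreDualityConsequences

end FiniteVariety

namespace FiniteVariety

open Limits Pretriangulated DerivedCategory

/-! ### Consequences of Serre duality: dimensions and embeddings -/

section SerreDualityConsequences

universe w'

variable {A : Type u} [Category.{v} A] [Abelian A] [HasDerivedCategory.{w'} A]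

/-- The vanishing hypothesis bounds the projective amplitude of `X` by `[-m, 0]`, and `P b` plays
the part of the leftmost term of a resolution. The induction removes one projective at a time,
replacing `X` by the desuspended cone. -/
lemma exists_boundedSingle_shift_factorization {ι : Type*} {P : ι → A}
    (hP : ∀ i, Projective (P i)) (hcov : ∀ M, ∃ (i : ι) (f : P i ⟶ M), Epi f) (j : ℕ) :
    ∀ (m : ℤ) (_ : m = j) (X : BoundedDerivedCategory A) (_ : (boundedTStructure A).IsLE X 0)
      (_ : ∀ (n : ℤ), m < n → ∀ (N : A) (f : X ⟶ ((boundedSingle A).obj N)⟦n⟧), f = 0),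
      ∃ (b : ι) (f : X ⟶ ((boundedSingle A).obj (P b))⟦m⟧),
        ∀ (a : ι) (g : X ⟶ ((boundedSingle A).obj (P a))⟦m⟧),
          ∃ h : (boundedSingle A).obj (P b) ⟶ (boundedSingle A).obj (P a), g = f ≫ h⟦m⟧' := by
  induction j with
  | zero =>
    rintro m rfl X _ hX
    obtain ⟨b, X', c, g, δ, hT, hX'⟩ := exists_projective_cover_triangle hP hcov X
    -- With `m = 0`, `X` has no maps to objects in degrees `≤ -1`, so the cover splits and `X` is a
    -- retract of `P b`.
    have hg : g = 0 := prop_of_isLE (ObjectProperty.singleton X).rightOrthogonal (-1)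
      (by
        rintro i hi M X f ⟨⟩
        exact hX _ (by push_cast; lia) M f) X' g (by simp)
    obtain ⟨s, hs⟩ : ∃ s : X ⟶ (boundedSingle A).obj (P b), 𝟙 X = s ≫ c :=
      Triangle.coyoneda_exact₂ _ hT (𝟙 X) (by subst hg; exact comp_zero)
    let e (M : A) : ((boundedSingle A).obj M)⟦((0 : ℕ) : ℤ)⟧ ≅ (boundedSingle A).obj M :=
      (shiftFunctorZero' _ _ (by simp)).app _
    refine ⟨b, s ≫ (e _).inv, fun a g' ↦ ⟨c ≫ g' ≫ (e _).hom, ?_⟩⟩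
    have hn := (shiftFunctorZero' (BoundedDerivedCategory A) ((0 : ℕ) : ℤ) (by simp)).inv.naturality
      (c ≫ g' ≫ (e (P a)).hom)
    have hn' : (e (P b)).inv ≫ (c ≫ g' ≫ (e (P a)).hom)⟦((0 : ℕ) : ℤ)⟧' =
      (c ≫ g' ≫ (e (P a)).hom) ≫ (e (P a)).inv := hn.symm
    rw [Category.assoc, hn', Category.assoc, Category.assoc, Iso.hom_inv_id, Category.comp_id,
      ← Category.assoc, ← hs, Category.id_comp]
  | succ j ih =>
    intro m hm X _ hX
    obtain ⟨i, X', c, g, δ, hT, hX'⟩ := exists_projective_cover_triangle hP hcov X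
    have := hP i
    let α : X' ≅ (X'⟦(-1 : ℤ)⟧)⟦(1 : ℤ)⟧ := (shiftEquiv _ (1 : ℤ)).counitIso.symm.app X'
    let β (n : ℤ) (M : A) : (((boundedSingle A).obj M)⟦n - 1⟧)⟦(1 : ℤ)⟧ ≅
        ((boundedSingle A).obj M)⟦n⟧ := (shiftFunctorAdd' _ (n - 1) 1 n (by lia)).symm.app _
    have key (n : ℤ) (hn : n ≠ 1) (N : A)
        (r : ((boundedSingle A).obj (P i))⟦(1 : ℤ)⟧ ⟶ ((boundedSingle A).obj N)⟦n⟧) : r = 0 := by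
      obtain ⟨r₀, hr₀⟩ := (shiftFunctor (BoundedDerivedCategory A) (1 : ℤ)).map_surjective
        (r ≫ (β n N).inv)
      rw [boundedSingle_hom_shift_eq_zero_of_projective (by lia) r₀, Functor.map_zero] at hr₀
      rw [← cancel_mono (β n N).inv, ← hr₀, zero_comp]
    obtain ⟨b, f₀, hf₀⟩ := ih (m - 1) (by lia) (X'⟦(-1 : ℤ)⟧)
      ((boundedTStructure A).isLE_shift X' (-1) (-1) 0) (fun n hn N f ↦ by
        obtain ⟨n, rfl⟩ : ∃ n', n = n' - 1 := ⟨n + 1, by lia⟩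
        apply (shiftFunctor (BoundedDerivedCategory A) (1 : ℤ)).map_injective
        rw [Functor.map_zero, ← cancel_epi α.hom, ← cancel_mono (β n N).hom, comp_zero, zero_comp]
        obtain ⟨r, hr⟩ : ∃ r : ((boundedSingle A).obj (P i))⟦(1 : ℤ)⟧ ⟶
            ((boundedSingle A).obj N)⟦n⟧, (α.hom ≫ f⟦(1 : ℤ)⟧') ≫ (β n N).hom = δ ≫ r :=
          Triangle.yoneda_exact₃ _ hT _ (hX n (by lia) N _)
        rw [hr, key n (by lia) N r, comp_zero])
    refine ⟨b, g ≫ α.hom ≫ f₀⟦(1 : ℤ)⟧' ≫ (β m (P b)).hom, fun a g' ↦ ?_⟩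
    obtain ⟨q, hq⟩ : ∃ q : X' ⟶ ((boundedSingle A).obj (P a))⟦m⟧, g' = g ≫ q :=
      Triangle.yoneda_exact₂ _ hT _ (boundedSingle_hom_shift_eq_zero_of_projective (by lia) _)
    obtain ⟨q₀, hq₀⟩ := (shiftFunctor (BoundedDerivedCategory A) (1 : ℤ)).map_surjective
      (α.inv ≫ q ≫ (β m (P a)).inv)
    obtain ⟨h, rfl⟩ := hf₀ a q₀
    refine ⟨h, ?_⟩
    have hn : (h⟦m - 1⟧')⟦(1 : ℤ)⟧' ≫ (β m (P a)).hom = (β m (P b)).hom ≫ h⟦m⟧' :=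
      (shiftFunctorAdd' (BoundedDerivedCategory A) (m - 1) 1 m (by lia)).inv.naturality h
    have hq' : q = α.hom ≫ (f₀ ≫ h⟦m - 1⟧')⟦(1 : ℤ)⟧' ≫ (β m (P a)).hom := by
      simp [hq₀]
    rw [hq, hq', Functor.map_comp]
    simp only [Category.assoc, hn]

variable {k : Type w} [Field k] [Linear k A]

namespace HasSerreDuality

lemma finiteDimensional_hom (h : HasSerreDuality k (BoundedDerivedCategory A)) (X Y : A) :
    FiniteDimensional k (X ⟶ Y) :=
  have := h.1 ((boundedSingle A).obj X) ((boundedSingle A).obj Y)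
  Module.Finite.equiv (homLinearEquiv (boundedSingle A) X Y).symm

/-- Serre duality turns `Ext^i` into maps to or from a partner of `M`. Since that partner is
bounded, these maps vanish by degrees for large `i`. -/
lemma objectsHaveFiniteDimensions (h : HasSerreDuality k (BoundedDerivedCategory A)) :
    ObjectsHaveFiniteDimensions A := by
  intro M
  constructor
  · obtain ⟨Z, η, hη⟩ := h.exists_right ((boundedSingle A).obj M)
    obtain ⟨a, ha⟩ := exists_isGE_boundedTStructure Z
    refine ⟨(1 - a).toNat, (hasProjectiveDimensionLT_iff_boundedSingle M _).2
      fun i hi N f ↦ hη.left f fun g ↦ ?_⟩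
    have hg : g = 0 := (boundedTStructure A).zero_of_isLE_of_isGE g (-i) a (by lia)
      inferInstance ha
    rw [hg, comp_zero, map_zero]
  · obtain ⟨X, hX⟩ := h.exists_left ((boundedSingle A).obj M)
    obtain ⟨b, hb⟩ := exists_isLE_boundedTStructure X
    refine ⟨b.toNat, (hasInjectiveDimensionLT_iff_boundedSingle M _).2 fun i hi N f ↦ ?_⟩
    obtain ⟨η, hη⟩ := hX.shift (i : ℤ)
    refine hη.right f fun g ↦ ?_
    have hg : g = 0 := (boundedTStructure A).zero_of_isLE_of_isGE g (b - i) 0 (by lia)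
      ((boundedTStructure A).isLE_shift X b i (b - i)) inferInstance
    rw [hg, zero_comp, map_zero]

variable {ι : Type*} {P : ι → A}

lemma exists_isSerreDual_projective (h : HasSerreDuality k (BoundedDerivedCategory A))
    (hP : ∀ i, Projective (P i)) (hcov : ∀ M, ∃ (i : ι) (f : P i ⟶ M), Epi f) (i : ι) :
    ∃ I, IsSerreDual k (P i) I := by
  obtain ⟨Z, hZ⟩ := h.exists_right ((boundedSingle A).obj (P i))
  have hZ' (j : ι) (n : ℤ) (hn : n ≠ 0) (f : ((boundedSingle A).obj (P j))⟦n⟧ ⟶ Z) : f = 0 := by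
    obtain ⟨η, hη⟩ := hZ
    have := hP i
    refine hη.right f fun g ↦ ?_
    rw [boundedSingle_hom_shift_eq_zero_of_projective hn g, zero_comp, map_zero]
  have := isLE_zero_of_hom_eq_zero hP hcov Z hZ'
  have := isGE_zero_of_hom_eq_zero hcov Z hZ'
  obtain ⟨I, ⟨e⟩⟩ := exists_iso_boundedSingle Z
  exact ⟨I, (hZ.of_iso (Iso.refl _) e).of_map (boundedSingle A)⟩

/-- A map out of the preimage `X` of `M` that is universal towards the projectives has as adjoint a
map `μ` out of `M` that is universal towards their injective partners. These partners detect nonzero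
objects, so `μ` has no kernel. -/
lemma exists_mono (h : HasSerreDuality k (BoundedDerivedCategory A))
    (hP : ∀ i, Projective (P i)) (hcov : ∀ M, ∃ (i : ι) (f : P i ⟶ M), Epi f) (M : A) :
    ∃ (i : ι) (I : A) (_ : IsSerreDual k (P i) I) (f : M ⟶ I), Mono f := by
  have := h.1
  have := h.finiteDimensional_hom
  choose I hI using h.exists_isSerreDual_projective hP hcov
  obtain ⟨X, hX⟩ := h.exists_left ((boundedSingle A).obj M)
  obtain ⟨b, hb⟩ := exists_isLE_boundedTStructure X
  -- The shift by `m` puts `X` in degrees `≤ 0`, as the factorization lemma requires.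
  generalize hm : (b.toNat : ℤ) = m
  have := (boundedTStructure A).isLE_shift X b m (b - m)
  choose θ hθ using fun i ↦ (hI i).boundedSingle.shift m
  obtain ⟨η, hη⟩ := hX.shift m
  obtain ⟨i, f, hf⟩ := exists_boundedSingle_shift_factorization hP hcov b.toNat m hm.symm (X⟦m⟧)
    ((boundedTStructure A).isLE_of_le _ (b - m) 0 (by lia)) (fun n hn N f ↦ hη.left f fun g ↦ by
      have hg : g = 0 := (boundedTStructure A).zero_of_isLE_of_isGE g (-n) (-m) (by lia)
        inferInstance inferInstance
      rw [hg, comp_zero, map_zero])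
  obtain ⟨s, hs⟩ := (hθ i).exists_map (η' := η) f
  obtain ⟨s, rfl⟩ := (shiftFunctor (BoundedDerivedCategory A) m).map_surjective s
  obtain ⟨μ, rfl⟩ := (boundedSingle A).map_surjective s
  have hμ (a : ι) (y : M ⟶ I a) : ∃ t : I i ⟶ I a, y = μ ≫ t := by
    obtain ⟨g, hg⟩ := hη.exists_preimage (η := θ a) (((boundedSingle A).map y)⟦m⟧')
    obtain ⟨h, rfl⟩ := hf a g
    obtain ⟨t, ht⟩ := (hθ a).exists_map (η' := θ i) (h⟦m⟧')
    obtain ⟨t, rfl⟩ := (shiftFunctor (BoundedDerivedCategory A) m).map_surjective t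
    obtain ⟨t, rfl⟩ := (boundedSingle A).map_surjective t
    refine ⟨t, (boundedSingle A).map_injective
      ((shiftFunctor (BoundedDerivedCategory A) m).map_injective ((hθ a).right_ext fun x ↦ ?_))⟩
    rw [← hg, Category.assoc, hs, Category.assoc, ht, Category.assoc, Functor.map_comp,
      Functor.map_comp]
  refine ⟨i, I i, hI i, μ, Preadditive.mono_of_isZero_kernel μ ?_⟩
  -- Any map from the kernel to `I a` extends to `M` by injectivity, hence factors through `μ` and
  -- vanishes; nondegeneracy then kills the cover `π`.
  obtain ⟨a, π, hπ⟩ := hcov (kernel μ)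
  have := (hI a).injective
  obtain ⟨ζ, hζ⟩ := hI a
  refine IsZero.of_epi_eq_zero π (hζ.left π fun z ↦ ?_)
  obtain ⟨t, ht⟩ := hμ a (Injective.factorThru z (kernel.ι μ))
  rw [← Injective.comp_factorThru z (kernel.ι μ), ht, kernel.condition_assoc, zero_comp, comp_zero,
    map_zero]

end HasSerreDuality

end SerreDualityConsequences

end FiniteVariety

namespace FiniteVariety

open Limits

/-! ### Finitely presented modules -/

section Modules

section RightExact

variable {k : Type v} [Field k] {J : Type u} [Category.{v} J]

lemma naturality_hom_apply {M N : J ⥤ ModuleCat.{v} k} (f : M ⟶ N) {X Y : J} (g : X ⟶ Y)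
    (x : M.obj X) :
    (f.app Y).hom ((M.map g).hom x) = (N.map g).hom ((f.app X).hom x) :=
  LinearMap.congr_fun (congrArg ModuleCat.Hom.hom (f.naturality g)) x

lemma app_hom_congr {M N : J ⥤ ModuleCat.{v} k} {f g : M ⟶ N} (h : f = g) {X : J} (x : M.obj X) :
    (f.app X).hom x = (g.app X).hom x := by rw [h]

lemma epi_iff_app_surjective {M N : J ⥤ ModuleCat.{v} k} (f : M ⟶ N) :
    Epi f ↔ ∀ X, Function.Surjective (f.app X).hom := by
  simp only [NatTrans.epi_iff_epi_app, ModuleCat.epi_iff_surjective]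

lemma mono_iff_app_injective {M N : J ⥤ ModuleCat.{v} k} (f : M ⟶ N) :
    Mono f ↔ ∀ X, Function.Injective (f.app X).hom := by
  simp only [NatTrans.mono_iff_mono_app, ModuleCat.mono_iff_injective]

/-- Evaluation at an object commutes with homology. -/
lemma exact_iff_app_exact (S : ShortComplex (J ⥤ ModuleCat.{v} k)) :
    S.Exact ↔ ∀ X, Function.Exact (S.f.app X).hom (S.g.app X).hom := by
  rw [ShortComplex.exact_iff_isZero_homology, Functor.isZero_iff]
  refine forall_congr' fun X ↦ ?_
  refine Iff.trans ?_ (ShortComplex.ShortExact.moduleCat_exact_iff_function_exact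
    (S.map ((evaluation _ _).obj X)))
  rw [ShortComplex.exact_iff_isZero_homology]
  exact (S.mapHomologyIso ((evaluation _ _).obj X)).symm.isZero_iff

/-- The sequence `M ⟶ N ⟶ L ⟶ 0` is exact at every object. -/
def IsRightExact {M N L : J ⥤ ModuleCat.{v} k} (f : M ⟶ N) (p : N ⟶ L) : Prop :=
  ∀ X, Function.Exact (f.app X).hom (p.app X).hom ∧ Function.Surjective (p.app X).hom

lemma isRightExact_cokernel {M N : J ⥤ ModuleCat.{v} k} (f : M ⟶ N) {c : CokernelCofork f}
    (hc : IsColimit c) : IsRightExact f c.π := by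
  have h := (exact_iff_app_exact (ShortComplex.mk f c.π c.condition)).1
    (ShortComplex.exact_of_g_is_cokernel _
      (IsColimit.ofIsoColimit hc (Cofork.ext (Iso.refl _) (by simp))))
  have := Cofork.IsColimit.epi hc
  exact fun X ↦ ⟨h X, (epi_iff_app_surjective c.π).1 inferInstance X⟩

lemma IsRightExact.exists_desc {M N L T : J ⥤ ModuleCat.{v} k} {f : M ⟶ N} {p : N ⟶ L}
    (h : IsRightExact f p) (q : N ⟶ T) (hq : f ≫ q = 0) : ∃ l : L ⟶ T, p ≫ l = q := by
  have w : f ≫ p = 0 := by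
    ext X x
    exact (h X).1.apply_apply_eq_zero x
  have hS : (ShortComplex.mk f p w).Exact := (exact_iff_app_exact _).2 fun X ↦ (h X).1
  have : Epi (ShortComplex.mk f p w).g := (epi_iff_app_surjective p).2 fun X ↦ (h X).2
  exact ⟨hS.desc q hq, hS.g_desc q hq⟩

lemma IsRightExact.comp_eq_zero {M N L : J ⥤ ModuleCat.{v} k} {f : M ⟶ N} {p : N ⟶ L}
    (h : IsRightExact f p) : f ≫ p = 0 := by
  ext X x
  exact (h X).1.apply_apply_eq_zero x

lemma IsRightExact.epi {M N L : J ⥤ ModuleCat.{v} k} {f : M ⟶ N} {p : N ⟶ L}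
    (h : IsRightExact f p) : Epi p :=
  (epi_iff_app_surjective p).2 fun X ↦ (h X).2

lemma IsRightExact.nonempty_iso {M N L M' N' L' : J ⥤ ModuleCat.{v} k} {f : M ⟶ N} {p : N ⟶ L}
    {f' : M' ⟶ N'} {p' : N' ⟶ L'} (h : IsRightExact f p) (h' : IsRightExact f' p') (e : M ≅ M')
    (e' : N ≅ N') (w : f ≫ e'.hom = e.hom ≫ f') : Nonempty (L ≅ L') := by
  have := h.epi
  have := h'.epi
  obtain ⟨l, hl⟩ := h.exists_desc (e'.hom ≫ p') (by
    rw [reassoc_of% w, h'.comp_eq_zero, comp_zero])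
  obtain ⟨l', hl'⟩ := h'.exists_desc (e'.inv ≫ p) (by
    rw [← cancel_epi e.hom, ← reassoc_of% w, e'.hom_inv_id_assoc, h.comp_eq_zero, comp_zero])
  refine ⟨⟨l, l', ?_, ?_⟩⟩
  · rw [← cancel_epi p, reassoc_of% hl, hl', e'.hom_inv_id_assoc, Category.comp_id]
  · rw [← cancel_epi p', reassoc_of% hl', hl, e'.inv_hom_id_assoc, Category.comp_id]

end RightExact

variable {k : Type v} [Field k] {𝔞 : Type u} [Category.{v} 𝔞] [Preadditive 𝔞]

lemma additive_of_surjective {M N : 𝔞ᵒᵖ ⥤ ModuleCat.{v} k} (p : N ⟶ M)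
    (hp : ∀ X, Function.Surjective (p.app X).hom) [N.Additive] : M.Additive where
  map_add {X Y f g} := by
    ext x
    obtain ⟨y, rfl⟩ := hp X x
    rw [← naturality_hom_apply, N.map_add, ModuleCat.hom_add, LinearMap.add_apply, map_add,
      naturality_hom_apply, naturality_hom_apply]
    rfl

variable [Linear k 𝔞]

lemma linear_of_surjective {M N : 𝔞ᵒᵖ ⥤ ModuleCat.{v} k} (p : N ⟶ M)
    (hp : ∀ X, Function.Surjective (p.app X).hom) [N.Additive] [N.Linear k] : M.Linear k where
  map_smul {X Y} f r := by
    ext x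
    obtain ⟨y, rfl⟩ := hp X x
    rw [← naturality_hom_apply, N.map_smul, ModuleCat.hom_smul, LinearMap.smul_apply, map_smul,
      naturality_hom_apply]
    rfl

instance (b : 𝔞) : ((linearYoneda k 𝔞).obj b).Linear k where
  map_smul f r := by
    ext x
    exact Linear.smul_comp _ _ _ r f.unop x

instance (M : FPMod k 𝔞) : M.obj.Additive := by
  obtain ⟨A, B, g, p, h⟩ := M.property
  exact additive_of_surjective p fun X ↦ (h X).2

instance (M : FPMod k 𝔞) : M.obj.Linear k := by
  obtain ⟨A, B, g, p, h⟩ := M.property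
  exact linear_of_surjective p fun X ↦ (h X).2

/-- The morphism from a standard projective which is given by an element. -/
def yonedaHom (M : 𝔞ᵒᵖ ⥤ ModuleCat.{v} k) [M.Additive] [M.Linear k] {b : 𝔞} (x : M.obj (op b)) :
    (linearYoneda k 𝔞).obj b ⟶ M where
  app Y := ModuleCat.ofHom (Y := M.obj Y)
    { toFun := fun f : Y.unop ⟶ b ↦ (M.map f.op).hom x
      map_add' := fun f g ↦ by
        rw [op_add, M.map_add]
        rfl
      map_smul' := fun r f ↦ by
        have : (r • f).op = r • f.op := rfl
        rw [this, M.map_smul]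
        rfl }
  naturality Y Z f := by
    ext g
    exact LinearMap.congr_fun (congrArg ModuleCat.Hom.hom (M.map_comp (Quiver.Hom.op g) f)) x

lemma yonedaHom_app_apply (M : 𝔞ᵒᵖ ⥤ ModuleCat.{v} k) [M.Additive] [M.Linear k] {b : 𝔞}
    (x : M.obj (op b)) {Y : 𝔞ᵒᵖ} (f : Y.unop ⟶ b) :
    ((yonedaHom M x).app Y).hom f = (M.map f.op).hom x := rfl

lemma yonedaHom_app_id (M : 𝔞ᵒᵖ ⥤ ModuleCat.{v} k) [M.Additive] [M.Linear k] {b : 𝔞}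
    (x : M.obj (op b)) : ((yonedaHom M x).app (op b)).hom (𝟙 b) = x := by
  rw [yonedaHom_app_apply, op_id, M.map_id]
  rfl

lemma linearYoneda_hom_app_apply {M : 𝔞ᵒᵖ ⥤ ModuleCat.{v} k} {b : 𝔞}
    (φ : (linearYoneda k 𝔞).obj b ⟶ M) {Y : 𝔞ᵒᵖ} (f : Y.unop ⟶ b) :
    (φ.app Y).hom f = (M.map f.op).hom ((φ.app (op b)).hom (𝟙 b)) := by
  refine Eq.trans ?_ (naturality_hom_apply φ f.op (𝟙 b : b ⟶ b))
  exact congrArg (φ.app Y).hom (Category.comp_id f).symm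

lemma linearYoneda_hom_ext {M : 𝔞ᵒᵖ ⥤ ModuleCat.{v} k} {b : 𝔞}
    {φ ψ : (linearYoneda k 𝔞).obj b ⟶ M}
    (h : (φ.app (op b)).hom (𝟙 b) = (ψ.app (op b)).hom (𝟙 b)) : φ = ψ := by
  ext Y f
  exact (linearYoneda_hom_app_apply φ f).trans
    ((congrArg (M.map (Quiver.Hom.op f)).hom h).trans (linearYoneda_hom_app_apply ψ f).symm)

lemma exists_linearYoneda_lift {M N : 𝔞ᵒᵖ ⥤ ModuleCat.{v} k} [N.Additive] [N.Linear k] (p : N ⟶ M)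
    (hp : ∀ X, Function.Surjective (p.app X).hom) {b : 𝔞} (φ : (linearYoneda k 𝔞).obj b ⟶ M) :
    ∃ ψ, ψ ≫ p = φ := by
  obtain ⟨y, hy⟩ := hp _ ((φ.app (op b)).hom (𝟙 b))
  refine ⟨yonedaHom N y, linearYoneda_hom_ext ?_⟩
  rw [← hy]
  exact congrArg (p.app (op b)).hom (yonedaHom_app_id N y)

instance : (isFinitelyPresented k 𝔞).IsClosedUnderIsomorphisms where
  of_iso := by
    rintro M N e ⟨A, B, g, p, h⟩
    have hp : Epi (p ≫ e.hom) :=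
      have := IsRightExact.epi h
      inferInstance
    refine ⟨A, B, g, p ≫ e.hom, fun X ↦ ⟨fun y ↦ ?_, (epi_iff_app_surjective _).1 hp X⟩⟩
    rw [← (h X).1 y]
    have he : Function.Injective (e.hom.app X).hom :=
      (mono_iff_app_injective e.hom).1 inferInstance X
    exact map_eq_zero_iff (e.hom.app X).hom he

lemma isFinitelyPresented_linearYoneda (b : 𝔞) :
    isFinitelyPresented k 𝔞 ((linearYoneda k 𝔞).obj b) :=
  ⟨b, b, 0, 𝟙 _, fun _ ↦
    ⟨fun _ ↦ ⟨fun h ↦ ⟨0, h.symm⟩, fun ⟨_, h⟩ ↦ h.symm⟩, Function.surjective_id⟩⟩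

variable (k) in
/-- The standard projective `𝔞(-, b)`. -/
def standardProjective (b : 𝔞) : FPMod k 𝔞 := ⟨_, isFinitelyPresented_linearYoneda b⟩

lemma isFinitelyPresented_of_isRightExact [HasBinaryBiproducts 𝔞] {M N L : 𝔞ᵒᵖ ⥤ ModuleCat.{v} k}
    {f : M ⟶ N} {q : N ⟶ L} (h : IsRightExact f q) (hM : isFinitelyPresented k 𝔞 M)
    (hN : isFinitelyPresented k 𝔞 N) : isFinitelyPresented k 𝔞 L := by
  obtain ⟨_, B, _, p, hp⟩ := hM
  obtain ⟨C, D, g, r, hr⟩ := hN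
  obtain ⟨l, hl⟩ := exists_linearYoneda_lift r (fun X ↦ (hr X).2) (p ≫ f)
  let Y := linearYoneda k 𝔞
  -- The relations of `L` are those of `N` together with lifts of the generators of `M`.
  refine ⟨C ⊞ B, D, Y.map biprod.fst ≫ g + Y.map biprod.snd ≫ l, r ≫ q, fun X ↦
    ⟨fun d ↦ ⟨fun hd ↦ ?_, ?_⟩, (h X).2.comp (hr X).2⟩⟩
  · obtain ⟨m, hm⟩ := ((h X).1 _).1 hd
    obtain ⟨β, rfl⟩ := (hp X).2 m
    have hl' : (r.app X).hom ((l.app X).hom β) = (f.app X).hom ((p.app X).hom β) :=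
      app_hom_congr hl β
    obtain ⟨γ, hγ⟩ := ((hr X).1 (d - (l.app X).hom β)).1 (by
      rw [map_sub, hl']
      exact sub_eq_zero.2 hm.symm)
    refine ⟨biprod.lift (show X.unop ⟶ C from γ) (show X.unop ⟶ B from β), ?_⟩
    refine (congrArg₂ (· + ·) (congrArg (g.app X).hom (biprod.lift_fst _ _))
      (congrArg (l.app X).hom (biprod.lift_snd _ _))).trans ?_
    exact (congrArg (· + _) hγ).trans (sub_add_cancel d _)
  · rintro ⟨z, rfl⟩
    have h₁ : (Y.map biprod.fst ≫ g + Y.map biprod.snd ≫ l) ≫ r ≫ q = 0 := by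
      rw [Preadditive.add_comp, Category.assoc, Category.assoc, reassoc_of% hl, h.comp_eq_zero,
        comp_zero, comp_zero, add_zero, reassoc_of% (IsRightExact.comp_eq_zero hr), zero_comp,
        comp_zero]
    exact app_hom_congr h₁ z

lemma isFinitelyPresented_biprod [HasBinaryBiproducts 𝔞] {M N : 𝔞ᵒᵖ ⥤ ModuleCat.{v} k}
    (hM : isFinitelyPresented k 𝔞 M) (hN : isFinitelyPresented k 𝔞 N) :
    isFinitelyPresented k 𝔞 (M ⊞ N) := by
  obtain ⟨A, B, g, p, hp⟩ := hM
  obtain ⟨C, D, g', r, hr⟩ := hN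
  have hp' := IsRightExact.comp_eq_zero hp
  have hr' := IsRightExact.comp_eq_zero hr
  let Y := linearYoneda k 𝔞
  have : Y.Additive := ⟨fun {X X' f f'} ↦ by
    ext Z z
    exact Preadditive.comp_add _ _ _ z f f'⟩
  let G : Y.obj (A ⊞ C) ⟶ Y.obj (B ⊞ D) :=
    Y.map biprod.fst ≫ g ≫ Y.map biprod.inl + Y.map biprod.snd ≫ g' ≫ Y.map biprod.inr
  let R : Y.obj (B ⊞ D) ⟶ M ⊞ N :=
    Y.map biprod.fst ≫ p ≫ biprod.inl + Y.map biprod.snd ≫ r ≫ biprod.inr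
  have hR₁ : R ≫ biprod.fst = Y.map biprod.fst ≫ p := by simp [R]
  have hR₂ : R ≫ biprod.snd = Y.map biprod.snd ≫ r := by simp [R]
  have hGR : G ≫ R = 0 := by
    simp only [G, R, Preadditive.add_comp, Preadditive.comp_add, Category.assoc,
      ← Y.map_comp_assoc, biprod.inl_fst, biprod.inl_snd, biprod.inr_fst, biprod.inr_snd,
      Functor.map_zero, zero_comp, comp_zero, Y.map_id, Category.id_comp, reassoc_of% hp',
      reassoc_of% hr', add_zero]
  refine ⟨A ⊞ C, B ⊞ D, G, R, fun X ↦ ⟨fun z ↦ ⟨fun hz ↦ ?_, ?_⟩, fun x ↦ ?_⟩⟩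
  · obtain ⟨γ, hγ⟩ := ((hp X).1 _).1 ((app_hom_congr hR₁ z).symm.trans
      ((congrArg ((biprod.fst : M ⊞ N ⟶ M).app X).hom hz).trans (map_zero _)))
    obtain ⟨δ, hδ⟩ := ((hr X).1 _).1 ((app_hom_congr hR₂ z).symm.trans
      ((congrArg ((biprod.snd : M ⊞ N ⟶ N).app X).hom hz).trans (map_zero _)))
    refine ⟨biprod.lift (show X.unop ⟶ A from γ) (show X.unop ⟶ C from δ), ?_⟩
    refine (congrArg₂ (fun (a : X.unop ⟶ B) (b : X.unop ⟶ D) ↦ a ≫ biprod.inl + b ≫ biprod.inr)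
      ((congrArg (g.app X).hom (biprod.lift_fst _ _)).trans hγ)
      ((congrArg (g'.app X).hom (biprod.lift_snd _ _)).trans hδ)).trans ?_
    have hz' : (show X.unop ⟶ B ⊞ D from z) ≫ 𝟙 _ = z := Category.comp_id _
    rw [← biprod.total, Preadditive.comp_add] at hz'
    refine Eq.trans ?_ hz'
    exact congrArg₂ (· + ·) (Category.assoc _ _ _) (Category.assoc _ _ _)
  · rintro ⟨z, rfl⟩
    exact app_hom_congr hGR z
  · obtain ⟨β, hβ⟩ := (hp X).2 (((biprod.fst : M ⊞ N ⟶ M).app X).hom x)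
    obtain ⟨δ, hδ⟩ := (hr X).2 (((biprod.snd : M ⊞ N ⟶ N).app X).hom x)
    refine ⟨biprod.lift (show X.unop ⟶ B from β) (show X.unop ⟶ D from δ), ?_⟩
    refine (congrArg₂ (fun a b ↦ ((biprod.inl : M ⟶ M ⊞ N).app X).hom a +
      ((biprod.inr : N ⟶ M ⊞ N).app X).hom b)
      ((congrArg (p.app X).hom (biprod.lift_fst _ _)).trans hβ)
      ((congrArg (r.app X).hom (biprod.lift_snd _ _)).trans hδ)).trans ?_
    exact app_hom_congr (biprod.total (X := M) (Y := N)) x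

instance [HasBinaryBiproducts 𝔞] : (isFinitelyPresented k 𝔞).IsClosedUnderCokernels where
  cokernels_le := by
    rintro L ⟨f, c, hc, hM, hN⟩
    exact isFinitelyPresented_of_isRightExact (isRightExact_cokernel f hc) hM hN

instance [HasBinaryBiproducts 𝔞] [HasZeroObject 𝔞] : (isFinitelyPresented k 𝔞).ContainsZero where
  exists_zero := by
    obtain ⟨Z, hZ⟩ := HasZeroObject.zero (C := 𝔞)
    exact ⟨_, (Functor.isZero_iff _).2 fun X ↦
      have : Subsingleton (((linearYoneda k 𝔞).obj Z).obj X) := ⟨fun _ _ ↦ hZ.eq_of_tgt _ _⟩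
      ModuleCat.isZero_of_subsingleton _, isFinitelyPresented_linearYoneda Z⟩

instance [HasBinaryBiproducts 𝔞] : HasBinaryBiproducts (FPMod k 𝔞) where
  has_binary_biproduct M N :=
    hasBinaryBiproduct_of_total
      { pt := ⟨M.obj ⊞ N.obj, isFinitelyPresented_biprod M.property N.property⟩
        fst := ObjectProperty.homMk biprod.fst
        snd := ObjectProperty.homMk biprod.snd
        inl := ObjectProperty.homMk biprod.inl
        inr := ObjectProperty.homMk biprod.inr
        inl_fst := by ext1; simp
        inl_snd := by ext1; simp
        inr_fst := by ext1; simp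
        inr_snd := by ext1; simp }
      (by ext1; exact biprod.total)

instance [HasBinaryBiproducts 𝔞] [HasZeroObject 𝔞] : HasFiniteProducts (FPMod k 𝔞) :=
  have : HasTerminal (FPMod k 𝔞) := HasZeroObject.hasTerminal
  have : HasBinaryProducts (FPMod k 𝔞) := hasBinaryProducts_of_hasBinaryBiproducts
  hasFiniteProducts_of_has_binary_and_terminal

/-- The pointwise cokernel is again finitely presented, so an epimorphism of `mod 𝔞` already has
zero cokernel among all functors. -/
lemma FPMod.epi_iff [HasBinaryBiproducts 𝔞] {M N : FPMod k 𝔞} (f : M ⟶ N) :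
    Epi f ↔ ∀ X, Function.Surjective (f.hom.app X).hom := by
  constructor
  · intro hf
    rw [← epi_iff_app_surjective]
    let L : FPMod k 𝔞 := ⟨cokernel f.hom, ObjectProperty.prop_cokernel _ _ M.property N.property⟩
    let π : N ⟶ L := ObjectProperty.homMk (cokernel.π f.hom)
    have hπ : π = 0 := (cancel_epi f).1 (by ext1; simp [π])
    exact Preadditive.epi_of_cokernel_zero (congrArg (fun g ↦ g.hom) hπ)
  · intro hf
    have := (epi_iff_app_surjective f.hom).2 hf
    exact ⟨fun g h w ↦ by
      ext1
      exact (cancel_epi f.hom).1 (congrArg (fun g ↦ g.hom) w)⟩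

instance [HasBinaryBiproducts 𝔞] (b : 𝔞) : Projective (standardProjective k b) where
  factors {E X} f e he := by
    obtain ⟨g, hg⟩ := exists_linearYoneda_lift e.hom ((FPMod.epi_iff e).1 he) f.hom
    exact ⟨ObjectProperty.homMk g, by ext1; exact hg⟩

lemma exists_epi_standardProjective [HasBinaryBiproducts 𝔞] (M : FPMod k 𝔞) :
    ∃ (b : 𝔞) (f : standardProjective k b ⟶ M), Epi f := by
  obtain ⟨A, B, g, p, h⟩ := M.property
  exact ⟨B, ObjectProperty.homMk p, (FPMod.epi_iff _).2 fun X ↦ (h X).2⟩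

/-- Evaluation of morphisms of modules at an element. -/
def evalHom {M N : FPMod k 𝔞} {X : 𝔞ᵒᵖ} (x : M.obj.obj X) : (M ⟶ N) →ₗ[k] N.obj.obj X where
  toFun f := (f.hom.app X).hom x
  map_add' _ _ := rfl
  map_smul' _ _ := rfl

section HomFinite

variable [∀ X Y : 𝔞, FiniteDimensional k (X ⟶ Y)]

instance (M : FPMod k 𝔞) (X : 𝔞ᵒᵖ) : FiniteDimensional k (M.obj.obj X) := by
  obtain ⟨A, B, g, p, h⟩ := M.property
  have : FiniteDimensional k (((linearYoneda k 𝔞).obj B).obj X) :=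
    inferInstanceAs (FiniteDimensional k (X.unop ⟶ B))
  exact Module.Finite.of_surjective (p.app X).hom (h X).2

instance (M N : FPMod k 𝔞) : FiniteDimensional k (M ⟶ N) := by
  obtain ⟨A, B, g, p, h⟩ := M.property
  refine Module.Finite.of_injective (evalHom (N := N) ((p.app (op B)).hom (𝟙 B))) fun f f' hf ↦ ?_
  have := IsRightExact.epi h
  ext1
  rw [← cancel_epi p]
  exact linearYoneda_hom_ext hf

end HomFinite

end Modules

end FiniteVariety

namespace FiniteVariety

open Limits

/-! ### The duality `D` and Serre partners of standard projectives -/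

section ModuleDual

variable {k : Type v} [Field k] {𝔞 : Type u} [Category.{v} 𝔞]

lemma isRightExact_moduleDual {K M N : 𝔞ᵒᵖ ⥤ ModuleCat.{v} k} {i : K ⟶ M} {f : M ⟶ N}
    (hi : ∀ X, Function.Injective (i.app X).hom)
    (h : ∀ X, Function.Exact (i.app X).hom (f.app X).hom) :
    IsRightExact ((moduleDual k 𝔞).map f.op) ((moduleDual k 𝔞).map i.op) := by
  refine fun Y ↦ ⟨fun θ ↦ ?_, LinearMap.dualMap_surjective_of_injective (hi Y.unop)⟩
  have h₁ : θ ∈ Set.range (((moduleDual k 𝔞).map f.op).app Y).hom ↔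
      θ ∈ (LinearMap.ker (f.app Y.unop).hom).dualAnnihilator := by
    rw [← LinearMap.range_dualMap_eq_dualAnnihilator_ker]
    exact Iff.rfl
  rw [h₁, LinearMap.exact_iff.1 (h Y.unop), ← LinearMap.ker_dualMap_eq_dualAnnihilator_range]
  exact Iff.rfl

lemma moduleDual_map_injective {M N : 𝔞ᵒᵖ ⥤ ModuleCat.{v} k} {f g : M ⟶ N}
    (h : (moduleDual k 𝔞).map f.op = (moduleDual k 𝔞).map g.op) : f = g := by
  ext X m
  rw [← sub_eq_zero, ← Module.forall_dual_apply_eq_zero_iff k]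
  intro θ
  rw [map_sub, sub_eq_zero]
  exact LinearMap.congr_fun (app_hom_congr h (X := op X) θ) m

/-- Transpose `φ` and identify `N` with its bidual; only the target has to be pointwise finite
dimensional. -/
lemma exists_moduleDual_map_eq {M N : 𝔞ᵒᵖ ⥤ ModuleCat.{v} k}
    [∀ X, FiniteDimensional k (N.obj X)]
    (φ : (moduleDual k 𝔞).obj (op N) ⟶ (moduleDual k 𝔞).obj (op M)) :
    ∃ f : M ⟶ N, (moduleDual k 𝔞).map f.op = φ := by
  let F (X : 𝔞ᵒᵖ) : Module.Dual k (N.obj X) →ₗ[k] Module.Dual k (M.obj X) := (φ.app (op X)).hom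
  let G (X : 𝔞ᵒᵖ) : M.obj X →ₗ[k] N.obj X :=
    (Module.evalEquiv k (N.obj X)).symm.toLinearMap ∘ₗ (F X).dualMap ∘ₗ Module.Dual.eval k (M.obj X)
  have hG (X : 𝔞ᵒᵖ) (m : M.obj X) (θ : Module.Dual k (N.obj X)) : θ (G X m) = F X θ m := by
    have := LinearMap.congr_fun ((Module.evalEquiv k (N.obj X)).apply_symm_apply
      ((F X).dualMap (Module.Dual.eval k (M.obj X) m))) θ
    exact this
  have hF {X Y : 𝔞ᵒᵖ} (g : X ⟶ Y) (θ : Module.Dual k (N.obj Y)) (m : M.obj X) :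
      F X (θ ∘ₗ (N.map g).hom) m = F Y θ ((M.map g).hom m) :=
    LinearMap.congr_fun (naturality_hom_apply φ g.op θ) m
  let f : M ⟶ N :=
    { app X := ModuleCat.ofHom (G X)
      naturality X Y g := by
        ext m
        rw [← sub_eq_zero, ← Module.forall_dual_apply_eq_zero_iff k]
        intro θ
        rw [map_sub, sub_eq_zero]
        exact (hG Y _ θ).trans ((hF g θ m).symm.trans (hG X m (θ ∘ₗ (N.map g).hom)).symm) }
  refine ⟨f, ?_⟩
  ext Y θ
  exact LinearMap.ext fun m ↦ hG Y.unop m θ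

lemma nonempty_iso_of_moduleDual {M N : 𝔞ᵒᵖ ⥤ ModuleCat.{v} k}
    [∀ X, FiniteDimensional k (N.obj X)] [∀ X, FiniteDimensional k (M.obj X)]
    (e : (moduleDual k 𝔞).obj (op N) ≅ (moduleDual k 𝔞).obj (op M)) : Nonempty (M ≅ N) := by
  obtain ⟨f, hf⟩ := exists_moduleDual_map_eq e.hom
  obtain ⟨g, hg⟩ := exists_moduleDual_map_eq e.inv
  exact ⟨⟨f, g, moduleDual_map_injective (by
    rw [op_comp, Functor.map_comp, hf, hg, e.inv_hom_id, op_id, CategoryTheory.Functor.map_id]),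
    moduleDual_map_injective (by
    rw [op_comp, Functor.map_comp, hf, hg, e.hom_inv_id, op_id, CategoryTheory.Functor.map_id])⟩⟩

instance [Preadditive 𝔞] (M : 𝔞ᵒᵖ ⥤ ModuleCat.{v} k) [M.Additive] :
    ((moduleDual k 𝔞).obj (op M)).Additive where
  map_add {X Y f g} := by
    ext θ
    refine LinearMap.ext fun m ↦ ?_
    have h : (M.map (f + g).unop).hom m = (M.map f.unop).hom m + (M.map g.unop).hom m := by
      rw [unop_add, M.map_add]
      rfl
    exact (congrArg (show Module.Dual k (M.obj X.unop) from θ) h).trans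
      (map_add (show Module.Dual k (M.obj X.unop) from θ) _ _)

variable [Preadditive 𝔞] [Linear k 𝔞]

instance (M : 𝔞ᵒᵖ ⥤ ModuleCat.{v} k) [M.Additive] [M.Linear k] :
    ((moduleDual k 𝔞).obj (op M)).Linear k where
  map_smul {X Y} f r := by
    ext θ
    refine LinearMap.ext fun m ↦ ?_
    have hr : (r • f).unop = r • f.unop := rfl
    have h : (M.map (r • f).unop).hom m = r • (M.map f.unop).hom m := by
      rw [hr, M.map_smul]
      rfl
    exact (congrArg (show Module.Dual k (M.obj X.unop) from θ) h).trans
      (map_smul (show Module.Dual k (M.obj X.unop) from θ) _ _)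

variable [∀ X Y : 𝔞, FiniteDimensional k (X ⟶ Y)]

/-- The universal element of `D I` is a form `ξ` on `I(b)`; by Yoneda `I(b)` is the space of maps
from `𝔞(-,b)` to `I`, so `ξ` is the trace. -/
lemma isSerreDual_standardProjective_of_iso {b : 𝔞} {I : FPMod k 𝔞}
    (e : (linearYoneda k 𝔞ᵒᵖ).obj (op b) ≅ (moduleDual k 𝔞).obj (op I.obj)) :
    IsSerreDual k (standardProjective k b) I := by
  let ξ : Module.Dual k (I.obj.obj (op b)) := (e.hom.app (op (op b))).hom (𝟙 (op b))
  have hξ {x : 𝔞ᵒᵖ} (h : x ⟶ op b) (z : I.obj.obj x) :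
      (show Module.Dual k (I.obj.obj x) from (e.hom.app (op x)).hom h) z =
        ξ ((I.obj.map h).hom z) :=
    LinearMap.congr_fun (linearYoneda_hom_app_apply e.hom (Y := op x) h) z
  have he : Epi e.hom := inferInstance
  rw [epi_iff_app_surjective] at he
  refine ⟨ξ ∘ₗ evalHom (show (standardProjective k b).obj.obj (op b) from 𝟙 b),
    fun {Y} f hf ↦ ?_, fun {Y} g hg ↦ ?_⟩
  · ext1
    refine linearYoneda_hom_ext ((Module.forall_dual_apply_eq_zero_iff k _).1 fun θ ↦ ?_)
    obtain ⟨g, hg⟩ := exists_moduleDual_map_eq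
      (e.inv ≫ yonedaHom ((moduleDual k 𝔞).obj (op Y.obj)) (b := op b) θ)
    have hθ : ξ ∘ₗ (g.app (op b)).hom = θ := by
      have h₁ : e.hom ≫ (moduleDual k 𝔞).map g.op =
          yonedaHom ((moduleDual k 𝔞).obj (op Y.obj)) (b := op b) θ := by
        rw [hg, e.hom_inv_id_assoc]
      exact (app_hom_congr h₁ (X := op (op b)) (𝟙 (op b))).trans (yonedaHom_app_id _ _)
    rw [← hθ]
    exact hf (ObjectProperty.homMk g)
  · ext1
    ext X z
    refine (Module.forall_dual_apply_eq_zero_iff k _).1 fun θ ↦ ?_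
    obtain ⟨h, rfl⟩ : ∃ h : X ⟶ op b, (e.hom.app (op X)).hom h = θ := he (op X) θ
    refine (hξ h _).trans ((congrArg ξ (naturality_hom_apply g.hom h z).symm).trans ?_)
    have := hg (ObjectProperty.homMk (yonedaHom Y.obj ((Y.obj.map h).hom z)))
    refine Eq.trans ?_ this
    exact congrArg (fun y ↦ ξ ((g.hom.app (op b)).hom y)) (yonedaHom_app_id Y.obj _).symm

lemma IsSerreDual.nonempty_iso_moduleDual {b : 𝔞} {I : FPMod k 𝔞}
    (h : IsSerreDual k (standardProjective k b) I) :
    Nonempty ((linearYoneda k 𝔞ᵒᵖ).obj (op b) ≅ (moduleDual k 𝔞).obj (op I.obj)) := by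
  obtain ⟨η, hη⟩ := h
  let E : (standardProjective k b ⟶ I) ≃ₗ[k] I.obj.obj (op b) :=
    LinearEquiv.ofBijective (evalHom (show (standardProjective k b).obj.obj (op b) from 𝟙 b))
      ⟨fun f g hfg ↦ by
        ext1
        exact linearYoneda_hom_ext hfg, fun z ↦
        ⟨ObjectProperty.homMk (yonedaHom I.obj z), yonedaHom_app_id I.obj z⟩⟩
  let ξ : Module.Dual k (I.obj.obj (op b)) := η ∘ₗ E.symm.toLinearMap
  have hξ (f : standardProjective k b ⟶ I) : ξ ((f.hom.app (op b)).hom (𝟙 b)) = η f :=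
    congrArg η (E.symm_apply_apply f)
  let ψ := yonedaHom ((moduleDual k 𝔞).obj (op I.obj)) (b := op b) ξ
  have hψ {x : 𝔞ᵒᵖ} (h : x ⟶ op b) (z : I.obj.obj x) :
      (show Module.Dual k (I.obj.obj x) from (ψ.app (op x)).hom h) z =
        ξ ((I.obj.map h).hom z) := rfl
  have hmono : Mono ψ := by
    refine (mono_iff_app_injective ψ).2 fun Y ↦ (injective_iff_map_eq_zero _).2 ?_
    intro (h : Y.unop ⟶ op b) hh
    let f : standardProjective k b ⟶ standardProjective k Y.unop.unop :=
      ObjectProperty.homMk ((linearYoneda k 𝔞).map h.unop)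
    have hf : f = 0 := hη.left f fun g ↦ by
      rw [← hξ]
      have h₁ : ((f ≫ g).hom.app (op b)).hom (𝟙 b) =
          (I.obj.map h).hom ((g.hom.app Y.unop).hom (𝟙 Y.unop.unop)) :=
        (congrArg (g.hom.app (op b)).hom (Category.id_comp h.unop)).trans
          (linearYoneda_hom_app_apply g.hom h.unop)
      rw [h₁, ← hψ, hh]
      rfl
    have h₂ : ((f.hom.app (op b)).hom (𝟙 b) : b ⟶ Y.unop.unop) = 0 := by
      rw [hf]
      rfl
    exact Quiver.Hom.unop_inj ((Category.id_comp h.unop).symm.trans h₂)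
  have hepi : Epi ψ := by
    refine (epi_iff_app_surjective ψ).2 fun Y ↦ ?_
    intro (θ : Module.Dual k (I.obj.obj Y.unop))
    obtain ⟨f, hf⟩ := hη.exists_left (θ ∘ₗ evalHom (N := I)
      (show (standardProjective k Y.unop.unop).obj.obj Y.unop from 𝟙 Y.unop.unop))
    let u : b ⟶ Y.unop.unop := (f.hom.app (op b)).hom (𝟙 b)
    refine ⟨u.op, LinearMap.ext fun z ↦ (hψ u.op z).trans ?_⟩
    let g : standardProjective k Y.unop.unop ⟶ I := ObjectProperty.homMk (yonedaHom I.obj z)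
    have h₁ : ((f ≫ g).hom.app (op b)).hom (𝟙 b) = (I.obj.map u.op).hom z := rfl
    rw [← h₁, hξ, hf]
    exact congrArg θ (yonedaHom_app_id I.obj z)
  have := isIso_of_mono_of_epi ψ
  exact ⟨asIso ψ⟩

end ModuleDual

end FiniteVariety

namespace FiniteVariety

open Limits

/-! ### Dualizing varieties -/

section Dualizing

variable {k : Type v} [Field k] {𝔞 : Type u} [Category.{v} 𝔞] [Preadditive 𝔞] [Linear k 𝔞]

lemma FPMod.mono_iff {M N : FPMod k 𝔞} (f : M ⟶ N) :
    Mono f ↔ ∀ X, Function.Injective (f.hom.app X).hom := by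
  constructor
  · intro hf X
    refine (injective_iff_map_eq_zero _).2 fun z hz ↦ ?_
    let g : standardProjective k X.unop ⟶ M := ObjectProperty.homMk (yonedaHom M.obj z)
    have hg : g = 0 := (cancel_mono f).1 (by
      rw [zero_comp]
      ext1
      refine linearYoneda_hom_ext ?_
      exact (congrArg (f.hom.app X).hom (yonedaHom_app_id M.obj z)).trans hz)
    refine (yonedaHom_app_id M.obj z).symm.trans ?_
    exact app_hom_congr (congrArg (fun φ ↦ φ.hom) hg) (X := X) (𝟙 X.unop)
  · intro hf
    have := (mono_iff_app_injective f.hom).2 hf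
    exact ⟨fun g h w ↦ by
      ext1
      exact (cancel_mono f.hom).1 (congrArg (fun g ↦ g.hom) w)⟩

/-- A kernel in `mod 𝔞` is automatically pointwise: by Yoneda, an element killed by `f` is a map
from a standard projective, to which the universal property applies. -/
lemma FPMod.exact_kernel {M N : FPMod k 𝔞} (f : M ⟶ N) [HasKernel f] (X : 𝔞ᵒᵖ) :
    Function.Exact ((kernel.ι f).hom.app X).hom (f.hom.app X).hom := by
  refine fun z ↦ ⟨fun hz ↦ ?_, ?_⟩
  · let g : standardProjective k X.unop ⟶ M := ObjectProperty.homMk (yonedaHom M.obj z)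
    have hg : g ≫ f = 0 := by
      ext1
      refine linearYoneda_hom_ext ?_
      exact (congrArg (f.hom.app X).hom (yonedaHom_app_id M.obj z)).trans hz
    refine ⟨((kernel.lift f g hg).hom.app X).hom (𝟙 X.unop), ?_⟩
    exact (app_hom_congr (congrArg (fun φ ↦ φ.hom) (kernel.lift_ι f g hg)) (X := X)
      (𝟙 X.unop)).trans (yonedaHom_app_id M.obj z)
  · rintro ⟨y, rfl⟩
    exact app_hom_congr (congrArg (fun φ ↦ φ.hom) (kernel.condition f)) y

variable [∀ X Y : 𝔞, FiniteDimensional k (X ⟶ Y)]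

/-- Full faithfulness of `D` is automatic because modules are pointwise finite dimensional. -/
lemma isDualizing_iff : IsDualizing k 𝔞 ↔
    (∀ M : FPMod k 𝔞, isFinitelyPresented k 𝔞ᵒᵖ ((moduleDual k 𝔞).obj (op M.obj))) ∧
      ∀ N : FPMod k 𝔞ᵒᵖ, ∃ M : FPMod k 𝔞,
        Nonempty (N.obj ≅ (moduleDual k 𝔞).obj (op M.obj)) := by
  constructor
  · rintro ⟨h, hF⟩
    refine ⟨fun M ↦ h (op M), fun N ↦ ?_⟩
    obtain ⟨M, ⟨e⟩⟩ := hF.essSurj.mem_essImage N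
    exact ⟨M.unop, ⟨((isFinitelyPresented k 𝔞ᵒᵖ).ι.mapIso e).symm⟩⟩
  · rintro ⟨h₁, h₂⟩
    refine ⟨fun M ↦ h₁ M.unop, ?_⟩
    exact
      { faithful := ⟨fun {M N f g} hfg ↦ by
          apply Quiver.Hom.unop_inj
          ext1
          exact moduleDual_map_injective (congrArg (fun φ ↦ φ.hom) hfg)⟩
        full := ⟨fun {M N} f ↦ by
          obtain ⟨g, hg⟩ := exists_moduleDual_map_eq (N := M.unop.obj) (M := N.unop.obj) f.hom
          exact ⟨Quiver.Hom.op (ObjectProperty.homMk g), by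
            ext1
            exact hg⟩⟩
        essSurj := ⟨fun N ↦ by
          obtain ⟨M, ⟨e⟩⟩ := h₂ N
          exact ⟨op M, ⟨ObjectProperty.isoMk _ e.symm⟩⟩⟩ }

lemma IsDualizing.exists_isSerreDual (h : IsDualizing k 𝔞) (b : 𝔞) :
    ∃ I, IsSerreDual k (standardProjective k b) I := by
  obtain ⟨I, ⟨e⟩⟩ := (isDualizing_iff.1 h).2 (standardProjective k (op b))
  exact ⟨I, isSerreDual_standardProjective_of_iso e⟩

variable [HasBinaryBiproducts 𝔞]

namespace IsDualizing

lemma isClosedUnderKernels (h : IsDualizing k 𝔞) :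
    (isFinitelyPresented k 𝔞).IsClosedUnderKernels where
  kernels_le := by
    rw [isDualizing_iff] at h
    rintro L ⟨f, c, hc, hM, hN⟩
    rename_i M N
    have := Fork.IsLimit.mono hc
    have hi := (mono_iff_app_injective c.ι).1 inferInstance
    have hex := (exact_iff_app_exact (ShortComplex.mk c.ι f c.condition)).1
      (ShortComplex.exact_of_f_is_kernel _
        (IsLimit.ofIsoLimit hc (Fork.ext (Iso.refl _) (by simp))))
    -- `D` turns the pointwise kernel into a cokernel of finitely presented modules; the result is
    -- then dualized back.
    have hL := isFinitelyPresented_of_isRightExact (isRightExact_moduleDual hi hex)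
      (h.1 ⟨_, hN⟩) (h.1 ⟨_, hM⟩)
    obtain ⟨M', ⟨e⟩⟩ := h.2 ⟨_, hL⟩
    have hfd (M : FPMod k 𝔞) (X : 𝔞ᵒᵖ) : FiniteDimensional k (M.obj.obj X) := inferInstance
    have (X : 𝔞ᵒᵖ) : FiniteDimensional k (c.pt.obj X) :=
      have : FiniteDimensional k (M.obj X) := hfd ⟨M, hM⟩ X
      Module.Finite.of_injective (c.ι.app X).hom (hi X)
    obtain ⟨e'⟩ := nonempty_iso_of_moduleDual e
    exact (isFinitelyPresented k 𝔞).prop_of_iso e' M'.property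

lemma isAbelian [HasZeroObject 𝔞] (h : IsDualizing k 𝔞) : IsAbelian (FPMod k 𝔞) :=
  have := h.isClosedUnderKernels
  { hasFiniteProducts := inferInstance
    hasKernels := inferInstance
    hasCokernels := inferInstance
    isNormalMonoCategory := inferInstance
    isNormalEpiCategory := inferInstance }

/-- A standard projective covering `D M` is of the form `D I`, so the cover is the dual of an
embedding of `M` in `I`. -/
lemma exists_mono (h : IsDualizing k 𝔞) (M : FPMod k 𝔞) :
    ∃ (b : 𝔞) (I : FPMod k 𝔞) (_ : IsSerreDual k (standardProjective k b) I) (f : M ⟶ I),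
      Mono f := by
  rw [isDualizing_iff] at h
  obtain ⟨b, p, hp⟩ := exists_epi_standardProjective (k := k) ⟨_, h.1 M⟩
  obtain ⟨I, ⟨e⟩⟩ := h.2 (standardProjective k b)
  obtain ⟨f, hf⟩ := exists_moduleDual_map_eq (e.inv ≫ p.hom)
  refine ⟨b.unop, I, isSerreDual_standardProjective_of_iso e, ObjectProperty.homMk f,
    (FPMod.mono_iff _).2 fun X ↦ (injective_iff_map_eq_zero _).2 fun z hz ↦ ?_⟩
  rw [← Module.forall_dual_apply_eq_zero_iff k]
  intro θ
  have : Epi ((moduleDual k 𝔞).map f.op) := by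
    have := (epi_iff_app_surjective p.hom).2 ((FPMod.epi_iff p).1 hp)
    rw [hf]
    infer_instance
  obtain ⟨θ', rfl⟩ := (epi_iff_app_surjective _).1 this (op X) θ
  exact (congrArg (show Module.Dual k (I.obj.obj X) from θ') hz).trans (map_zero _)

theorem satisfiesSerreDuality (h : IsDualizing k 𝔞) (hA : IsAbelian (FPMod k 𝔞))
    (hdim : letI := hA.abelian; ObjectsHaveFiniteDimensions (FPMod k 𝔞)) :
    letI := hA.abelian; SatisfiesSerreDuality k (FPMod k 𝔞) := by
  let := hA.abelian
  let := HasDerivedCategory.standard (FPMod k 𝔞)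
  have : EnoughProjectives (FPMod k 𝔞) := ⟨fun M ↦ by
    obtain ⟨b, f, hf⟩ := exists_epi_standardProjective M
    exact ⟨{ p := _, f := f }⟩⟩
  have : EnoughInjectives (FPMod k 𝔞) := ⟨fun M ↦ by
    obtain ⟨b, I, hI, f, hf⟩ := h.exists_mono M
    exact ⟨{ J := I, injective := hI.injective, f := f }⟩⟩
  refine hasSerreDuality_boundedDerivedCategory (k := k) (A := FPMod k 𝔞) hdim (fun P hP ↦ ?_)
    (fun I hI ↦ ?_)
  · obtain ⟨b, f, hf⟩ := exists_epi_standardProjective P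
    obtain ⟨J, hJ⟩ := h.exists_isSerreDual b
    obtain ⟨I, -, hI⟩ := hJ.exists_of_retract_left
      ⟨Projective.factorThru (𝟙 P) f, f, Projective.factorThru_comp _ _⟩
    exact ⟨I, hI⟩
  · obtain ⟨b, J, hJ, f, hf⟩ := h.exists_mono I
    obtain ⟨P, -, hP⟩ := hJ.exists_of_retract_right
      ⟨f, Injective.factorThru (𝟙 I) f, Injective.comp_factorThru _ _⟩
    exact ⟨P, hP⟩

end IsDualizing

/-- A copresentation `0 → M → I → J` by partners of standard projectives dualizes to a presentation
of `D M` by representables. Conversely a presentation of `N` is `D` applied to some `J ⟶ I`, and `N`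
is the dual of its kernel. -/
theorem isDualizing_of_isSerreDual [HasKernels (FPMod k 𝔞)]
    (h₁ : ∀ b : 𝔞, ∃ I, IsSerreDual k (standardProjective k b) I)
    (h₂ : ∀ M : FPMod k 𝔞, ∃ (b : 𝔞) (I : FPMod k 𝔞)
      (_ : IsSerreDual k (standardProjective k b) I) (f : M ⟶ I), Mono f) : IsDualizing k 𝔞 := by
  have hD {b : 𝔞} {I : FPMod k 𝔞} (hI : IsSerreDual k (standardProjective k b) I) :
      isFinitelyPresented k 𝔞ᵒᵖ ((moduleDual k 𝔞).obj (op I.obj)) := by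
    obtain ⟨e⟩ := hI.nonempty_iso_moduleDual
    exact (isFinitelyPresented k 𝔞ᵒᵖ).prop_of_iso e (isFinitelyPresented_linearYoneda (op b))
  refine isDualizing_iff.2 ⟨fun M ↦ ?_, fun N ↦ ?_⟩
  · obtain ⟨b, I, hI, f, hf⟩ := h₂ M
    let C : FPMod k 𝔞 :=
      ⟨cokernel f.hom, ObjectProperty.prop_cokernel _ _ M.property I.property⟩
    obtain ⟨c, J, hJ, g, hg⟩ := h₂ C
    have hC := isRightExact_cokernel f.hom (cokernelIsCokernel f.hom)
    rw [FPMod.mono_iff] at hf hg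
    refine isFinitelyPresented_of_isRightExact
      (isRightExact_moduleDual (f := cokernel.π f.hom ≫ g.hom) hf fun X z ↦ ?_) (hD hJ) (hD hI)
    rw [← (hC X).1 z]
    exact map_eq_zero_iff (g.hom.app X).hom (hg X)
  · obtain ⟨A, B, g, p, hp⟩ := N.property
    obtain ⟨I, hI⟩ := h₁ A.unop
    obtain ⟨J, hJ⟩ := h₁ B.unop
    obtain ⟨e⟩ := hI.nonempty_iso_moduleDual
    obtain ⟨e'⟩ := hJ.nonempty_iso_moduleDual
    obtain ⟨u, hu⟩ := exists_moduleDual_map_eq (e.inv ≫ g ≫ e'.hom)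
    let u' : J ⟶ I := ObjectProperty.homMk u
    have hK := isRightExact_moduleDual
      ((FPMod.mono_iff (kernel.ι u')).1 inferInstance) (FPMod.exact_kernel u')
    exact ⟨kernel u', IsRightExact.nonempty_iso hp hK e e' (by
      refine Eq.trans ?_ (congrArg (e.hom ≫ ·) hu).symm
      simp)⟩

end Dualizing

end FiniteVariety

/-! ### The equivalence -/

theorem mainTheorem3 (k : Type v) [Field k] [IsAlgClosed k] (𝔞 : Type u) [Category.{v} 𝔞]
    [Preadditive 𝔞] [Linear k 𝔞] [FiniteVariety.IsFiniteVariety k 𝔞] :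
    (∃ h : FiniteVariety.IsAbelian (FiniteVariety.FPMod k 𝔞),
      letI := h.abelian
      FiniteVariety.SatisfiesSerreDuality k (FiniteVariety.FPMod k 𝔞)) ↔
    (FiniteVariety.IsDualizing k 𝔞 ∧
      ∀ h : FiniteVariety.IsAbelian (FiniteVariety.FPMod k 𝔞),
        letI := h.abelian
        FiniteVariety.ObjectsHaveFiniteDimensions (FiniteVariety.FPMod k 𝔞)) := by
  have := FiniteVariety.IsFiniteVariety.hasFiniteBiproducts k (𝔞 := 𝔞)
  have := FiniteVariety.IsFiniteVariety.finiteDimensional_hom (k := k) (𝔞 := 𝔞)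
  have := Limits.hasBinaryBiproducts_of_finite_biproducts 𝔞
  have := Limits.hasZeroObject_of_hasFiniteBiproducts 𝔞
  have hP (b : 𝔞) : Projective (FiniteVariety.standardProjective k b) := inferInstance
  constructor
  · rintro ⟨h, hS⟩
    let := h.abelian
    let := HasDerivedCategory.standard (FiniteVariety.FPMod k 𝔞)
    have hS' : FiniteVariety.HasSerreDuality k
      (FiniteVariety.BoundedDerivedCategory (FiniteVariety.FPMod k 𝔞)) := hS
    have hcov := FiniteVariety.exists_epi_standardProjective (k := k) (𝔞 := 𝔞)
    exact ⟨FiniteVariety.isDualizing_of_isSerreDual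
      (hS'.exists_isSerreDual_projective hP hcov) (hS'.exists_mono hP hcov),
      -- By proof irrelevance, any two proofs of `IsAbelian` give the same abelian structure.
      fun _ ↦ hS'.objectsHaveFiniteDimensions⟩
  · rintro ⟨h, hdim⟩
    exact ⟨h.isAbelian, h.satisfiesSerreDuality h.isAbelian (hdim h.isAbelian)⟩
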